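/- Fix an integer $D\ge 2$, an interaction length $\xi\in\mathbb{N}$, constants $c_0,\alpha>0$, constants $C,v\ge 0$ and $\gamma>0$, and an error $\varepsilon<1$. Then there are $c>0$ and $d_0\in\mathbb{N}$, depending only on these data, such that the following holds. Let $\Lambda$ be a finite $D$-dimensional rectangular lattice (with any side lengths, and with open or periodic boundary conditions in each direction) with $n$ sites, with the maximum-coordinate distance $\mathrm{dist}$, and with a qudit of dimension $p\ge 2$ at each site. Let $\mathcal{C}\subset(\mathbb{C}^p)^{\otimes n}$ be a $D$-dimensional topological code, that is, the simultaneous $+1$-eigenspace of finitely many pairwise commuting orthogonal projections, each supported on a set of sites of diameter at most $\xi$, whose code distance $d$ satisfies $d\ge c_0 n^{\alpha}$. Here $d$ is the least number of qudits that support an operator $O$ for which $P_{\mathcal{C}}OP_{\mathcal{C}}$ is not a multiple of the orthogonal projection $P_{\mathcal{C}}$ onto $\mathcal{C}$; it is assumed to exist. Let $A\subset\Lambda$ be a set of $\kappa$ qudits, let $|\Phi\rangle=\bigotimes_{j\in\Lambda\setminus A}|\Phi_j\rangle$ be a product of unit vectors, and let $\mathcal{C}_*=(\mathbb{C}^p)^{\otimes\kappa}\otimes\mathbb{C}|\Phi\rangle$.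 Let $\{\mathcal{E}^{(t)}\}_{t\ge 0}$ be a family of completely positive trace-preserving maps on the operators on $(\mathbb{C}^p)^{\otimes n}$ that is of Lieb-Robinson type with constants $C,v,\gamma$: for all $t\ge 0$, all real $r>0$ and all $B\subset\Lambda$ there is a completely positive trace-preserving map $\mathcal{E}^{(t)}_{B(r)}$ supported on $B(r)=\{x\in\Lambda : \mathrm{dist}(x,B)\le r\}$ such that $$\big\|(\mathcal{E}^{(t)})^\dagger(O_B)-(\mathcal{E}^{(t)}_{B(r)})^\dagger(O_B)\big\|_\infty\le \|O_B\|_\infty\,|B|\,Ce^{vt-\gamma r}$$ for every Hermitian operator $O_B$ supported on $B$, where $\dagger$ is the adjoint with respect to the Hilbert-Schmidt inner product. Suppose that for some $t>0$ the map $\mathcal{E}^{(t)}$ encodes $\mathcal{C}_*$ into $\mathcal{C}$ with error $\varepsilon$: there is a unitary $U$ on $(\mathbb{C}^p)^{\otimes n}$ with $U\mathcal{C}_*=\mathcal{C}$ such that $\|\mathcal{E}^{(t)}(\rho)-U\rho U^\dagger\|_1\le\varepsilon$ for every density operator $\rho$ with support in $\mathcal{C}_*$. If $d\ge d_0$, then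 $t\ge c\,d^{1/(D-1)}$. -/

import Mathlib

open scoped Matrix ComplexOrder

/-! Operators, states and channels. -/

/-- Operators on the Hilbert space with orthonormal basis indexed by `X`, as matrices. -/
abbrev Op (X : Type) := Matrix X X ℂ

/-- Linear maps between operators on the Hilbert space with basis `X`. -/
abbrev SuperOp (X : Type) := Op X →ₗ[ℂ] Op X

/-- The operator norm with respect to the Euclidean (Hilbert space) norm. -/
noncomputable def opNorm {X : Type} [Fintype X] [DecidableEq X] (M : Op X) : ℝ :=
  ‖Matrix.toEuclideanCLM (n := X) (𝕜 := ℂ) M‖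

/-- The trace norm `tr √(M† M)`, the sum of the singular values of `M`. -/
noncomputable def traceNorm {X : Type} [Fintype X] [DecidableEq X] (M : Op X) : ℝ :=
  ∑ i, Real.sqrt ((Matrix.isHermitian_conjTranspose_mul_self M).eigenvalues i)

/-- Complete positivity: for every `k`, the map `id ⊗ E` on operators on `ℂ^k ⊗ ℂ^X` preserves
positive semidefiniteness. -/
def IsCompletelyPositive {X : Type} [Fintype X] [DecidableEq X] (E : SuperOp X) : Prop :=
  ∀ (k : ℕ) (M : Matrix (Fin k × X) (Fin k × X) ℂ), M.PosSemidef →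
    (Matrix.of fun (a b : Fin k × X) =>
      E (Matrix.of fun x y => M (a.1, x) (b.1, y)) a.2 b.2).PosSemidef

/-- Completely positive trace-preserving maps. -/
def IsCPTP {X : Type} [Fintype X] [DecidableEq X] (E : SuperOp X) : Prop :=
  IsCompletelyPositive E ∧ ∀ M : Op X, (E M).trace = M.trace

/-- The adjoint of `E` for the Hilbert-Schmidt inner product `⟨M, N⟩ = tr(M† N)`. -/
noncomputable def hsAdjoint {X : Type} [Fintype X] [DecidableEq X] (E : SuperOp X) (O : Op X) :
    Op X :=
  Matrix.of fun x y => ((E (Matrix.single x y 1))ᴴ * O).trace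

/-- The defining property of the Hilbert-Schmidt adjoint. -/
theorem trace_conjTranspose_mul_hsAdjoint {X : Type} [Fintype X] [DecidableEq X] (E : SuperOp X)
    (M O : Op X) : (Mᴴ * hsAdjoint E O).trace = ((E M)ᴴ * O).trace := by
  conv_rhs => rw [Matrix.matrix_eq_sum_single M]
  simp only [map_sum, Matrix.conjTranspose_sum, Finset.sum_mul, Matrix.trace_sum]
  have h : ∀ x y, ((E (Matrix.single x y (M x y)))ᴴ * O).trace
      = star (M x y) * hsAdjoint E O x y := by
    intro x y
    have h1 : Matrix.single x y (M x y) = M x y • Matrix.single x y (1 : ℂ) := by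
      simp [Matrix.smul_single]
    rw [h1, map_smul, Matrix.conjTranspose_smul, Matrix.smul_mul, Matrix.trace_smul]
    rfl
  simp only [h]
  simp only [Matrix.trace, Matrix.diag, Matrix.mul_apply, Matrix.conjTranspose_apply]
  exact Finset.sum_comm

/-! Many qudits: `Λ` is the set of qudits, each with basis `Fin p`, so that `Λ → Fin p` indexes
the product basis. -/

/-- The operator `M ⊗ 1`, where `M` acts on the qudits in `S`. -/
def extendOp {Λ : Type} [Fintype Λ] [DecidableEq Λ] {p : ℕ} (S : Finset Λ)
    (M : Op (S → Fin p)) : Op (Λ → Fin p) :=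
  Matrix.of fun x y =>
    if ∀ i, i ∉ S → x i = y i then M (fun i => x i) (fun i => y i) else 0

/-- `O` acts trivially on all qudits outside `S`. -/
def SupportedOn {Λ : Type} [Fintype Λ] [DecidableEq Λ] {p : ℕ} (S : Finset Λ)
    (O : Op (Λ → Fin p)) : Prop :=
  ∃ M : Op (S → Fin p), O = extendOp S M

/-- The basis label that equals `u` on `S` and `x` outside `S`. -/
def glue {Λ : Type} [DecidableEq Λ] {p : ℕ} (S : Finset Λ) (u : S → Fin p) (x : Λ → Fin p) :
    Λ → Fin p :=
  fun i => if h : i ∈ S then u ⟨i, h⟩ else x i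

/-- The map `F ⊗ id`, where `F` acts on the qudits in `S`. -/
def extendMap {Λ : Type} [Fintype Λ] [DecidableEq Λ] {p : ℕ} (S : Finset Λ)
    (F : SuperOp (S → Fin p)) : SuperOp (Λ → Fin p) where
  toFun M := Matrix.of fun x y =>
    F (Matrix.of fun u v => M (glue S u x) (glue S v y)) (fun i => x i) (fun i => y i)
  map_add' M N := by
    ext x y
    exact congrFun (congrFun (F.map_add (Matrix.of fun u v => M (glue S u x) (glue S v y))
      (Matrix.of fun u v => N (glue S u x) (glue S v y))) _) _
  map_smul' a M := by
    ext x y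
    exact congrFun (congrFun
      (F.map_smul a (Matrix.of fun u v => M (glue S u x) (glue S v y))) _) _

/-! The lattice. -/

/-- A `D`-dimensional rectangular lattice: side length and boundary condition (periodic or open)
in each of the `D` directions. -/
structure BoxLattice (D : ℕ) where
  side : Fin D → ℕ
  periodic : Fin D → Bool

/-- The sites (vertices) of the lattice. -/
abbrev BoxLattice.Site {D : ℕ} (G : BoxLattice D) : Type := (i : Fin D) → Fin (G.side i)

/-- The distance of two sites along one direction. -/
def BoxLattice.coordDist {D : ℕ} (G : BoxLattice D) (i : Fin D) (a b : Fin (G.side i)) : ℕ :=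
  if G.periodic i then min (Nat.dist a b) (G.side i - Nat.dist a b) else Nat.dist a b

/-- The distance of two sites: the maximum of their distances along the `D` directions. It is at
most the graph distance and at most the Euclidean distance, so that bounds on diameters and
supports in neighborhoods for those distances imply the same for this one. -/
def BoxLattice.siteDist {D : ℕ} (G : BoxLattice D) (x y : G.Site) : ℕ :=
  Finset.univ.sup fun i => G.coordDist i (x i) (y i)

open Classical in
/-- The `r`-neighborhood `{x | d(x, B) ≤ r}` of a region `B`. -/
noncomputable def BoxLattice.nbhd {D : ℕ} (G : BoxLattice D) (B : Finset G.Site) (r : ℝ) :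
    Finset G.Site :=
  Finset.univ.filter fun x => ∃ y ∈ B, (G.siteDist x y : ℝ) ≤ r

/-! Codes. -/

/-- A code given by pairwise commuting projections, each supported on a region of diameter at
most `ξ`. -/
structure LocalProjectorCode {D : ℕ} (G : BoxLattice D) (p ξ : ℕ) where
  /-- The number of projections. -/
  m : ℕ
  /-- The projections. -/
  proj : Fin m → Op (G.Site → Fin p)
  isHermitian : ∀ a, (proj a).IsHermitian
  idempotent : ∀ a, proj a * proj a = proj a
  commute : ∀ a b, proj a * proj b = proj b * proj a
  isLocal : ∀ a, ∃ S : Finset G.Site, SupportedOn S (proj a) ∧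
    ∀ x ∈ S, ∀ y ∈ S, G.siteDist x y ≤ ξ

/-- The code space: the simultaneous `+1`-eigenspace of the projections. -/
def LocalProjectorCode.space {D : ℕ} {G : BoxLattice D} {p ξ : ℕ}
    (K : LocalProjectorCode G p ξ) : Submodule ℂ ((G.Site → Fin p) → ℂ) where
  carrier := {ψ | ∀ a, K.proj a *ᵥ ψ = ψ}
  add_mem' := by
    intro ψ χ hψ hχ a
    rw [Matrix.mulVec_add, hψ a, hχ a]
  zero_mem' := by
    intro a
    exact Matrix.mulVec_zero _
  smul_mem' := by
    intro c ψ hψ a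
    rw [Matrix.mulVec_smul, hψ a]

/-- `O` is detectable for the code space `V`: it is proportional to the identity when compressed
to `V` (that is, `P O P = c P` for the orthogonal projection `P` onto `V`). -/
def IsDetectable {X : Type} [Fintype X] (V : Submodule ℂ (X → ℂ)) (O : Op X) : Prop :=
  ∃ c : ℂ, ∀ ψ ∈ V, ∀ χ ∈ V, star ψ ⬝ᵥ (O *ᵥ χ) = c * (star ψ ⬝ᵥ χ)

/-- `d` is the code distance: the least number of qudits that support an operator which is not
detectable. -/
def LocalProjectorCode.HasDistance {D : ℕ} {G : BoxLattice D} {p ξ : ℕ}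
    (K : LocalProjectorCode G p ξ) (d : ℕ) : Prop :=
  IsLeast {w : ℕ | ∃ (S : Finset G.Site) (O : Op (G.Site → Fin p)),
    S.card = w ∧ SupportedOn S O ∧ ¬ IsDetectable K.space O} d

/-! Encoders. -/

/-- The map `χ ↦ χ ⊗ Φ`, where `χ` is a vector of the qudits in `A` and `Φ` is the product of the
vectors `φ j` of the other qudits `j`. -/
noncomputable def tensorProductState {Λ : Type} [Fintype Λ] [DecidableEq Λ] {p : ℕ}
    (A : Finset Λ) (φ : {j : Λ // j ∉ A} → EuclideanSpace ℂ (Fin p)) :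
    ((A → Fin p) → ℂ) →ₗ[ℂ] ((Λ → Fin p) → ℂ) where
  toFun χ := fun x => χ (fun i => x i) * ∏ j, φ j (x j)
  map_add' χ χ' := by
    ext x
    simp [add_mul]
  map_smul' c χ := by
    ext x
    simp [mul_assoc]

/-- The space `C_* = (ℂ^p)^{⊗ A} ⊗ ℂ Φ` of unencoded states. -/
noncomputable def unencodedSpace {Λ : Type} [Fintype Λ] [DecidableEq Λ] {p : ℕ}
    (A : Finset Λ) (φ : {j : Λ // j ∉ A} → EuclideanSpace ℂ (Fin p)) :
    Submodule ℂ ((Λ → Fin p) → ℂ) :=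
  LinearMap.range (tensorProductState A φ)

/-- Density operators with support in the subspace `V`. -/
def IsStateOn {X : Type} [Fintype X] (V : Submodule ℂ (X → ℂ)) (ρ : Op X) : Prop :=
  ρ.PosSemidef ∧ ρ.trace = 1 ∧ ∀ ψ, ρ *ᵥ ψ ∈ V

/-- `E` encodes `V₀` into `V` with error `ε`: for some unitary `U` that maps `V₀` onto `V`, the
trace-norm distance of `E ρ` and `U ρ U†` is at most `ε` for all states `ρ` with support
in `V₀`. -/
def Encodes {X : Type} [Fintype X] [DecidableEq X] (E : SuperOp X)
    (V₀ V : Submodule ℂ (X → ℂ)) (ε : ℝ) : Prop :=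
  ∃ U ∈ Matrix.unitaryGroup X ℂ, V₀.map (Matrix.toLin' U) = V ∧
    ∀ ρ : Op X, IsStateOn V₀ ρ → traceNorm (E ρ - U * ρ * Uᴴ) ≤ ε

/-! Locality-preserving evolutions. -/

/-- `E` is localizable with error `err r`. -/
def IsLocalizable {D : ℕ} (G : BoxLattice D) {p : ℕ} (E : SuperOp (G.Site → Fin p))
    (err : ℝ → ℝ) : Prop :=
  ∀ r : ℝ, 0 < r → ∀ B : Finset G.Site,
    ∃ F : SuperOp (G.nbhd B r → Fin p), IsCPTP F ∧
      ∀ O : Op (G.Site → Fin p), O.IsHermitian → SupportedOn B O →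
        opNorm (hsAdjoint E O - hsAdjoint (extendMap (G.nbhd B r) F) O)
          ≤ opNorm O * (B.card : ℝ) * err r

/-- The family `E t`, `t ≥ 0`, is of Lieb-Robinson type with constants `C`, `v`, `γ`. -/
def IsLiebRobinson {D : ℕ} (G : BoxLattice D) {p : ℕ} (E : ℝ → SuperOp (G.Site → Fin p))
    (C v γ : ℝ) : Prop :=
  ∀ t : ℝ, 0 ≤ t → IsLocalizable G (E t) fun r => C * Real.exp (v * t - γ * r)

/-! A code of distance `d` hides its information not only from sets of fewer than `d` qudits, but
from whole balls of radius `R` proportional to `d ^ (1 / (D - 1))`, because only the boundary layer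
of such a ball has to be smaller than `d`. A fast encoder cannot move the information of a single
unencoded qudit out of such a ball.

Correctable balls. By the expansion lemma `isCorrectable_union`, a correctable region `M` can be
enlarged by a shell `N₂` if the shell together with an inner boundary layer `N₁` of `M` is
correctable. The reason is that, between code vectors, every operator on `M` agrees with an operator
on `N₁` (`exists_mem_compression_eq`, a double-commutant argument), so every operator on `M ∪ N₂`
can be cleaned to `N₁ ∪ N₂`. For balls these layers have at most a constant times `R ^ (D - 1)`
sites (`card_layer_le`), and `HasDistance.isCorrectable_ball` grows the ball site layer by site
layer.

Lower bound on the time. Since the code has a distance, it is not one-dimensional, so some site `a`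
lies in `A`. Two unencoded product vectors that differ only in the basis label at `a` are encoded
into orthogonal code vectors. The ball around `a` is correctable, so an observable `O` with values
`±1` on its complement tells these two apart (`exists_distinguishing_op`). Up to the Lieb-Robinson
error, pulling `O` back through the evolution gives the same result as pulling it back through a
channel on the `R`-neighborhood of the complement. That neighborhood misses `a`, so the channel
yields equal expectation values for the two initial vectors. Hence `1 - ε ≤ n * C * exp (v * t - γ *
R)`. As `n` is at most polynomial in `d`, this fails for large `d` when `t` is a small multiple of
`d ^ (1 / (D - 1))` (`exists_radius`). -/

/-! Orthogonal projections as matrices, and compressions. -/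

/-- Every subspace is the range of a Hermitian projection matrix. -/
theorem exists_isHermitian_projection {X : Type} [Fintype X] [DecidableEq X]
    (W : Submodule ℂ (X → ℂ)) :
    ∃ w : Matrix X X ℂ, w.IsHermitian ∧ (∀ v, w *ᵥ v ∈ W) ∧ ∀ v ∈ W, w *ᵥ v = v := by
  let W' : Submodule ℂ (EuclideanSpace ℂ X) := W.comap (WithLp.linearEquiv 2 ℂ (X → ℂ)).toLinearMap
  let w : Matrix X X ℂ := (Matrix.toEuclideanCLM (n := X) (𝕜 := ℂ)).symm W'.starProjection
  have hw : Matrix.toEuclideanCLM (n := X) (𝕜 := ℂ) w = W'.starProjection :=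
    StarAlgEquiv.apply_symm_apply _ _
  have hv : ∀ v : X → ℂ, w *ᵥ v = (W'.starProjection (WithLp.toLp 2 v)).ofLp := by
    intro v
    rw [← hw, Matrix.toEuclideanCLM_toLp]
  refine ⟨w, ?_, ?_, ?_⟩
  · have h : star w = w := by
      apply (Matrix.toEuclideanCLM (n := X) (𝕜 := ℂ)).injective
      have h1 : Matrix.toEuclideanCLM (n := X) (𝕜 := ℂ) (star w)
          = star (Matrix.toEuclideanCLM (n := X) (𝕜 := ℂ) w) := map_star _ w
      exact h1.trans ((congrArg star hw).trans
        ((isSelfAdjoint_starProjection W').star_eq.trans hw.symm))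
    exact h
  · intro v
    rw [hv]
    exact W'.starProjection_apply_mem _
  · intro v hvW
    rw [hv]
    have : W'.starProjection (WithLp.toLp 2 v) = WithLp.toLp 2 v :=
      Submodule.starProjection_eq_self_iff.mpr hvW
    rw [this]

/-- A matrix that leaves a subspace and its orthogonal complement invariant commutes with the
projection onto the subspace. -/
theorem projection_commute_of_invariant {X : Type} [Fintype X] [DecidableEq X]
    {W : Submodule ℂ (X → ℂ)} {w : Matrix X X ℂ} (hw : w.IsHermitian)
    (hmem : ∀ v, w *ᵥ v ∈ W) (hfix : ∀ v ∈ W, w *ᵥ v = v) {A : Matrix X X ℂ}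
    (hA : ∀ v ∈ W, A *ᵥ v ∈ W) (hA' : ∀ v ∈ W, Aᴴ *ᵥ v ∈ W) : A * w = w * A := by
  have key : ∀ B : Matrix X X ℂ, (∀ v ∈ W, B *ᵥ v ∈ W) → w * (B * w) = B * w := by
    intro B hB
    apply Matrix.ext_of_mulVec_single
    intro i
    rw [← Matrix.mulVec_mulVec]
    apply hfix
    rw [← Matrix.mulVec_mulVec]
    exact hB _ (hmem _)
  -- Invariance under `A` gives `w A w = A w`. Invariance under `Aᴴ` gives `w A w = w A` after
  -- taking adjoints.
  have h1 := key A hA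
  have h2 := congrArg Matrix.conjTranspose (key Aᴴ hA')
  simp only [Matrix.conjTranspose_mul, Matrix.conjTranspose_conjTranspose, hw.eq] at h2
  rw [← h1, ← Matrix.mul_assoc, h2]

/-- If the only elements of the commutant of `𝒮` on the columns of `Ψ` are scalars, then every
operator agrees with an element of `𝒮` when compressed to the columns of `Ψ`. -/
theorem exists_mem_compression_eq {ι J : Type} [Fintype ι] [DecidableEq ι] [Fintype J]
    [DecidableEq J] (𝒮 : StarSubalgebra ℂ (Matrix ι ι ℂ)) (Ψ : Matrix ι J ℂ)
    (hΨ : ∀ Z : Matrix ι ι ℂ, (∀ S ∈ 𝒮, S * Z = Z * S) →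
      (∀ Q : Matrix ι ι ℂ, (∀ S ∈ 𝒮, Q * S = S * Q) → Q * Ψ = Ψ → Q * Z = Z) →
      ∃ z : ℂ, Z * Ψ = z • Ψ) (X : Matrix ι ι ℂ) :
    ∃ S ∈ 𝒮, Ψᴴ * S * Ψ = Ψᴴ * X * Ψ := by
  by_cases h0 : Ψ = 0
  · exact ⟨0, 𝒮.zero_mem, by simp [h0]⟩
  -- The matrices `S * Ψ` with `S ∈ 𝒮`, flattened to vectors. Projecting `X * Ψ` onto this space
  -- will produce the required `S`.
  let W : Submodule ℂ (ι × J → ℂ) :=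
    { carrier := {v | ∃ S ∈ 𝒮, ∀ i j, v (i, j) = (S * Ψ) i j}
      add_mem' := by
        rintro v v' ⟨S, hS, h⟩ ⟨S', hS', h'⟩
        exact ⟨S + S', add_mem hS hS', fun i j => by simp [h, h', Matrix.add_mul]⟩
      zero_mem' := ⟨0, 𝒮.zero_mem, fun i j => by simp⟩
      smul_mem' := by
        rintro c v ⟨S, hS, h⟩
        exact ⟨c • S, 𝒮.smul_mem hS c, fun i j => by simp [h]⟩ }
  obtain ⟨w, hw, hmem, hfix⟩ := exists_isHermitian_projection W
  let b : J → J → Matrix ι ι ℂ := fun j k => Matrix.of fun i i' => w (i, j) (i', k)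
  have hbH : ∀ j k, (b j k)ᴴ = b k j := by
    intro j k
    ext i i'
    exact congrFun (congrFun hw.eq (i, k)) (i', j)
  have hamp : ∀ (S : Matrix ι ι ℂ) (v : ι × J → ℂ) (i : ι) (j : J),
      (Matrix.kroneckerMap (· * ·) S (1 : Matrix J J ℂ) *ᵥ v) (i, j)
        = ∑ i', S i i' * v (i', j) := by
    intro S v i j
    simp [Matrix.mulVec, dotProduct, Fintype.sum_prod_type, Matrix.one_apply]
  have hinv : ∀ S ∈ 𝒮, ∀ v ∈ W,
      Matrix.kroneckerMap (· * ·) S (1 : Matrix J J ℂ) *ᵥ v ∈ W := by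
    rintro S hS v ⟨T, hT, h⟩
    refine ⟨S * T, mul_mem hS hT, fun i j => ?_⟩
    rw [hamp, Matrix.mul_assoc, Matrix.mul_apply]
    simp [h]
  -- `W` is invariant under `S ⊗ 1` and its adjoint, so `w` commutes with `S ⊗ 1`. Blockwise this
  -- puts every `b j k` into the commutant of `𝒮`.
  have hcomm : ∀ S ∈ 𝒮, ∀ j k, S * b j k = b j k * S := by
    intro S hS j k
    have h := projection_commute_of_invariant hw hmem hfix (hinv S hS) (by
      have h1 : (Matrix.kroneckerMap (· * ·) S (1 : Matrix J J ℂ))ᴴ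
          = Matrix.kroneckerMap (· * ·) Sᴴ (1 : Matrix J J ℂ) := by
        simpa using Matrix.conjTranspose_kronecker S (1 : Matrix J J ℂ)
      rw [h1]
      exact hinv _ (star_mem hS))
    ext i i'
    have h2 := congrFun (congrFun h (i, j)) (i', k)
    simp only [Matrix.mul_apply, Fintype.sum_prod_type, Matrix.kroneckerMap_apply,
      Matrix.one_apply, mul_ite, mul_one, mul_zero, ite_mul, zero_mul, Finset.sum_ite_eq,
      Finset.sum_ite_eq', Finset.mem_univ, if_true] at h2
    simpa [Matrix.mul_apply, b] using h2
  have hcol : ∀ j k i', ∃ S ∈ 𝒮, ∀ i, b j k i i' = (S * Ψ) i j := by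
    intro j k i'
    obtain ⟨S, hS, h⟩ := hmem (Pi.single (i', k) 1)
    refine ⟨S, hS, fun i => ?_⟩
    rw [← h i j]
    simp [b]
  -- The columns of `b j k` are `j`-th columns of matrices `S * Ψ`. A `Q` in the commutant that
  -- fixes `Ψ` therefore fixes `b j k`, and the hypothesis applies.
  have hz : ∀ j k, ∃ z : ℂ, b j k * Ψ = z • Ψ := by
    intro j k
    refine hΨ _ (fun S hS => hcomm S hS j k) ?_
    intro Q hQ hQΨ
    ext i i'
    obtain ⟨S, hS, h⟩ := hcol j k i'
    calc (Q * b j k) i i' = (Q * (S * Ψ)) i j := by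
          rw [Matrix.mul_apply, Matrix.mul_apply]
          exact Finset.sum_congr rfl fun x _ => by rw [h x]
      _ = (S * Ψ) i j := by rw [← Matrix.mul_assoc, hQ S hS, Matrix.mul_assoc, hQΨ]
      _ = b j k i i' := (h i).symm
  choose z hz using hz
  have hz' : ∀ j k, Ψᴴ * b j k = star (z k j) • Ψᴴ := by
    intro j k
    have h := congrArg Matrix.conjTranspose (hz k j)
    rwa [Matrix.conjTranspose_mul, hbH, Matrix.conjTranspose_smul] at h
  -- Both scalars arise from `Ψᴴ * b j k * Ψ`. Comparing them requires `Ψ ≠ 0`.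
  have hzz : ∀ j k, star (z k j) = z j k := by
    intro j k
    have h : star (z k j) • (Ψᴴ * Ψ) = z j k • (Ψᴴ * Ψ) := by
      rw [← Matrix.smul_mul, ← hz', Matrix.mul_assoc, hz, Matrix.mul_smul]
    have hne : Ψᴴ * Ψ ≠ 0 := fun h1 => h0 (Matrix.conjTranspose_mul_self_eq_zero.mp h1)
    exact smul_left_injective ℂ hne h
  have hwv : ∀ (B : Matrix ι J ℂ) i j,
      (w *ᵥ fun x => B x.1 x.2) (i, j) = ∑ k, (b j k * B) i k := by
    intro B i j
    simp only [Matrix.mulVec, dotProduct, Fintype.sum_prod_type, Matrix.mul_apply]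
    exact Finset.sum_comm
  have hΨW : (fun x : ι × J => Ψ x.1 x.2) ∈ W := ⟨1, 𝒮.one_mem, fun i j => by simp⟩
  -- `Ψ` itself lies in `W`, so `w` fixes it. Hence the scalar matrix `z`, to which `w` reduces on
  -- `Ψ`, drops out in the final computation.
  have hsum : ∀ i j, Ψ i j = ∑ k, z j k * Ψ i k := by
    intro i j
    have h := congrFun (hfix _ hΨW) (i, j)
    rw [hwv] at h
    simpa [hz] using h.symm
  obtain ⟨S, hS, h⟩ := hmem fun x => (X * Ψ) x.1 x.2
  refine ⟨S, hS, ?_⟩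
  ext l j
  calc (Ψᴴ * S * Ψ) l j = ∑ k, (Ψᴴ * (b j k * (X * Ψ))) l k := by
        rw [Matrix.mul_assoc, Matrix.mul_apply]
        simp only [← h, hwv, Finset.mul_sum]
        rw [Finset.sum_comm]
        rfl
    _ = ∑ k, z j k * (Ψᴴ * X * Ψ) l k := by
        refine Finset.sum_congr rfl fun k _ => ?_
        rw [← Matrix.mul_assoc, hz', hzz, Matrix.smul_mul, ← Matrix.mul_assoc]
        rfl
    _ = (Ψᴴ * X * Ψ) l j := by
        simp only [Matrix.mul_apply (M := Ψᴴ * X), Finset.mul_sum]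
        rw [Finset.sum_comm]
        refine Finset.sum_congr rfl fun i _ => ?_
        rw [hsum i j, Finset.mul_sum]
        exact Finset.sum_congr rfl fun k _ => by ring

/-! Hölder's inequality for the trace norm. -/

/-- The trace is computed in an eigenbasis `v` of `Mᴴ * M`. There the norms of the vectors `M v i`
are the singular values of `M`, and Cauchy-Schwarz bounds each diagonal term. -/
theorem norm_trace_mul_le_opNorm_mul_traceNorm {X : Type} [Fintype X] [DecidableEq X]
    (O M : Op X) : ‖(O * M).trace‖ ≤ opNorm O * traceNorm M := by
  let hM := Matrix.isHermitian_conjTranspose_mul_self M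
  let v := hM.eigenvectorBasis
  let T := Matrix.toEuclideanCLM (n := X) (𝕜 := ℂ)
  have htr : (O * M).trace = ∑ i, inner ℂ (v i) (T (O * M) (v i)) := by
    have h1 := LinearMap.trace_eq_sum_inner (T (O * M)).toLinearMap v
    have h2 : LinearMap.trace ℂ _ (T (O * M)).toLinearMap = (O * M).trace := by
      rw [LinearMap.trace_eq_matrix_trace ℂ (EuclideanSpace.basisFun X ℂ).toBasis]
      congr 1
      ext i j
      simp [LinearMap.toMatrix_apply, T]
      rfl
    rw [← h2, h1]
    rfl
  have hnorm : ∀ i, ‖T M (v i)‖ = Real.sqrt (hM.eigenvalues i) := by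
    intro i
    rw [eq_comm, Real.sqrt_eq_iff_mul_self_eq]
    · have h1 : inner ℂ (T M (v i)) (T M (v i)) = inner ℂ (v i) (T (Mᴴ * M) (v i)) := by
        have hs : T Mᴴ = ContinuousLinearMap.adjoint (T M) := map_star T M
        rw [map_mul, hs]
        exact (ContinuousLinearMap.adjoint_inner_right (T M) (v i) (T M (v i))).symm
      have h2 : T (Mᴴ * M) (v i) = (hM.eigenvalues i : ℂ) • v i := by
        ext x
        have h3 := congrFun (hM.mulVec_eigenvectorBasis i) x
        simpa [T, v] using h3
      rw [h2, inner_smul_right, inner_self_eq_norm_sq_to_K, inner_self_eq_norm_sq_to_K,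
        v.orthonormal.1 i] at h1
      have h4 : ((‖T M (v i)‖ ^ 2 : ℝ) : ℂ) = ((hM.eigenvalues i : ℝ) : ℂ) := by
        simpa using h1
      have h5 := Complex.ofReal_injective h4
      rw [← h5]; ring
    · exact Matrix.eigenvalues_conjTranspose_mul_self_nonneg M i
    · exact norm_nonneg _
  rw [htr, traceNorm, Finset.mul_sum]
  refine (norm_sum_le _ _).trans (Finset.sum_le_sum fun i _ => ?_)
  calc ‖inner ℂ (v i) (T (O * M) (v i))‖ ≤ ‖v i‖ * ‖T (O * M) (v i)‖ := norm_inner_le_norm _ _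
    _ = ‖T O (T M (v i))‖ := by rw [v.orthonormal.1 i, one_mul, map_mul]; rfl
    _ ≤ ‖T O‖ * ‖T M (v i)‖ := (T O).le_opNorm _
    _ = opNorm O * Real.sqrt (hM.eigenvalues i) := by rw [hnorm]; rfl

theorem opNorm_le_one_of_isHermitian_of_sq_eq_one {X : Type} [Fintype X] [DecidableEq X]
    {O : Op X} (hO : O.IsHermitian) (h : O * O = 1) : opNorm O ≤ 1 := by
  have h1 : Oᴴ * O = 1 := by rw [hO.eq, h]
  have h2 : opNorm O * opNorm O ≤ 1 := by
    have h3 : Matrix.toEuclideanCLM (n := X) (𝕜 := ℂ) Oᴴ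
        = star (Matrix.toEuclideanCLM (n := X) (𝕜 := ℂ) O) := map_star _ O
    have h4 := CStarRing.norm_star_mul_self (x := Matrix.toEuclideanCLM (n := X) (𝕜 := ℂ) O)
    rw [← h3, ← map_mul, h1, map_one] at h4
    unfold opNorm
    rw [← h4]
    exact ContinuousLinearMap.norm_id_le
  have h5 : 0 ≤ opNorm O := norm_nonneg _
  nlinarith

/-! Splitting configurations along a region. -/

section Regions

variable {Λ : Type} [DecidableEq Λ] {p : ℕ}

/-- The configuration that equals `u` on `M` and `k` outside `M`. -/
def joinConfig (M : Finset Λ) (u : M → Fin p) (k : {j : Λ // j ∉ M} → Fin p) : Λ → Fin p :=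
  fun i => if h : i ∈ M then u ⟨i, h⟩ else k ⟨i, h⟩

@[simp] theorem joinConfig_of_mem {M : Finset Λ} (u : M → Fin p) (k : {j : Λ // j ∉ M} → Fin p)
    {i : Λ} (h : i ∈ M) : joinConfig M u k i = u ⟨i, h⟩ := by simp [joinConfig, h]

@[simp] theorem joinConfig_of_notMem {M : Finset Λ} (u : M → Fin p)
    (k : {j : Λ // j ∉ M} → Fin p) {i : Λ} (h : i ∉ M) : joinConfig M u k i = k ⟨i, h⟩ := by
  simp [joinConfig, h]

@[simp] theorem joinConfig_restrict (M : Finset Λ) (x : Λ → Fin p) :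
    joinConfig M (fun i => x i) (fun i => x i) = x := by
  ext i
  by_cases h : i ∈ M <;> simp [h]

theorem restrict_joinConfig (M : Finset Λ) (u : M → Fin p)
    (k : {j : Λ // j ∉ M} → Fin p) : (fun i : M => joinConfig M u k i) = u := by
  ext i
  simp

theorem restrict_compl_joinConfig (M : Finset Λ) (u : M → Fin p)
    (k : {j : Λ // j ∉ M} → Fin p) : (fun i : {j : Λ // j ∉ M} => joinConfig M u k i) = k := by
  ext i
  simp [i.2]

theorem joinConfig_agree_iff (M : Finset Λ) (u u' : M → Fin p)
    (k k' : {j : Λ // j ∉ M} → Fin p) :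
    (∀ i, i ∉ M → joinConfig M u k i = joinConfig M u' k' i) ↔ k = k' := by
  constructor
  · intro h
    ext i
    simpa [i.2] using congrArg Fin.val (h i i.2)
  · rintro rfl i hi
    simp [hi]

theorem ext_joinConfig (M : Finset Λ) {A B : Op (Λ → Fin p)}
    (h : ∀ u k u' k', A (joinConfig M u k) (joinConfig M u' k')
      = B (joinConfig M u k) (joinConfig M u' k')) : A = B := by
  ext x y
  have := h (fun i => x i) (fun i => x i) (fun i => y i) (fun i => y i)
  simpa using this

/-- The block of `O` with indices `k` and `k'` outside `M`. -/
def opBlock (M : Finset Λ) (O : Op (Λ → Fin p)) (k k' : {j : Λ // j ∉ M} → Fin p) :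
    Op (M → Fin p) :=
  Matrix.of fun u u' => O (joinConfig M u k) (joinConfig M u' k')

variable [Fintype Λ]

theorem sum_joinConfig {R : Type*} [AddCommMonoid R] (M : Finset Λ) (f : (Λ → Fin p) → R) :
    ∑ x, f x = ∑ u : M → Fin p, ∑ k : {j : Λ // j ∉ M} → Fin p, f (joinConfig M u k) := by
  rw [← Fintype.sum_prod_type' (fun u k => f (joinConfig M u k))]
  exact (Equiv.sum_comp (Equiv.piEquivPiSubtypeProd (· ∈ M) (fun _ : Λ => Fin p)).symm f).symm

/-! Operators supported on a region. -/

theorem extendOp_joinConfig (M : Finset Λ) (A : Op (M → Fin p)) (u u' : M → Fin p)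
    (k k' : {j : Λ // j ∉ M} → Fin p) :
    extendOp M A (joinConfig M u k) (joinConfig M u' k') = if k = k' then A u u' else 0 := by
  simp only [extendOp, Matrix.of_apply, joinConfig_agree_iff, restrict_joinConfig]

theorem extendOp_mul_apply (M : Finset Λ) (A : Op (M → Fin p)) (O : Op (Λ → Fin p))
    (u u' : M → Fin p) (k k' : {j : Λ // j ∉ M} → Fin p) :
    (extendOp M A * O) (joinConfig M u k) (joinConfig M u' k') = (A * opBlock M O k k') u u' := by
  rw [Matrix.mul_apply, sum_joinConfig M, Matrix.mul_apply]
  simp [extendOp_joinConfig, opBlock]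

theorem mul_extendOp_apply (M : Finset Λ) (A : Op (M → Fin p)) (O : Op (Λ → Fin p))
    (u u' : M → Fin p) (k k' : {j : Λ // j ∉ M} → Fin p) :
    (O * extendOp M A) (joinConfig M u k) (joinConfig M u' k') = (opBlock M O k k' * A) u u' := by
  rw [Matrix.mul_apply, sum_joinConfig M, Matrix.mul_apply]
  simp [extendOp_joinConfig, opBlock]

theorem opBlock_extendOp (M : Finset Λ) (A : Op (M → Fin p))
    (k k' : {j : Λ // j ∉ M} → Fin p) :
    opBlock M (extendOp M A) k k' = if k = k' then A else 0 := by
  ext u u'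
  rw [opBlock, Matrix.of_apply, extendOp_joinConfig]
  split_ifs <;> rfl

theorem extendOp_mul (M : Finset Λ) (A B : Op (M → Fin p)) :
    extendOp M (A * B) = extendOp M A * extendOp M B := by
  apply ext_joinConfig M
  intro u k u' k'
  rw [extendOp_mul_apply, opBlock_extendOp, extendOp_joinConfig]
  split_ifs <;> simp

theorem extendOp_add (M : Finset Λ) (A B : Op (M → Fin p)) :
    extendOp M (A + B) = extendOp M A + extendOp M B := by
  ext x y
  simp only [extendOp, Matrix.of_apply, Matrix.add_apply]
  split_ifs <;> simp

theorem extendOp_smul (M : Finset Λ) (c : ℂ) (A : Op (M → Fin p)) :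
    extendOp M (c • A) = c • extendOp M A := by
  ext x y
  simp only [extendOp, Matrix.of_apply, Matrix.smul_apply]
  split_ifs <;> simp

theorem extendOp_one (M : Finset Λ) : extendOp M (1 : Op (M → Fin p)) = 1 := by
  ext x y
  simp only [extendOp, Matrix.of_apply, Matrix.one_apply]
  by_cases h : x = y
  · simp [h]
  · rw [if_neg h]
    split_ifs with h1 h2
    · exact absurd (funext fun i => if hi : i ∈ M then congrFun h2 ⟨i, hi⟩ else h1 i hi) h
    · rfl
    · rfl

theorem extendOp_conjTranspose (M : Finset Λ) (A : Op (M → Fin p)) :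
    extendOp M Aᴴ = (extendOp M A)ᴴ := by
  ext x y
  simp only [extendOp, Matrix.of_apply, Matrix.conjTranspose_apply, eq_comm]
  split_ifs <;> simp

theorem extendOp_injective [NeZero p] (M : Finset Λ) :
    Function.Injective (extendOp M : Op (M → Fin p) → Op (Λ → Fin p)) := by
  intro A B h
  ext u u'
  have := congrFun (congrFun h (joinConfig M u 0)) (joinConfig M u' 0)
  simpa [extendOp_joinConfig] using this

theorem SupportedOn.mul {S : Finset Λ} {A B : Op (Λ → Fin p)} (hA : SupportedOn S A)
    (hB : SupportedOn S B) : SupportedOn S (A * B) := by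
  obtain ⟨a, rfl⟩ := hA
  obtain ⟨b, rfl⟩ := hB
  exact ⟨a * b, (extendOp_mul S a b).symm⟩

theorem SupportedOn.add {S : Finset Λ} {A B : Op (Λ → Fin p)} (hA : SupportedOn S A)
    (hB : SupportedOn S B) : SupportedOn S (A + B) := by
  obtain ⟨a, rfl⟩ := hA
  obtain ⟨b, rfl⟩ := hB
  exact ⟨a + b, (extendOp_add S a b).symm⟩

theorem SupportedOn.smul {S : Finset Λ} {A : Op (Λ → Fin p)} (hA : SupportedOn S A) (c : ℂ) :
    SupportedOn S (c • A) := by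
  obtain ⟨a, rfl⟩ := hA
  exact ⟨c • a, (extendOp_smul S c a).symm⟩

theorem SupportedOn.one (S : Finset Λ) : SupportedOn S (1 : Op (Λ → Fin p)) :=
  ⟨1, (extendOp_one S).symm⟩

theorem SupportedOn.conjTranspose {S : Finset Λ} {A : Op (Λ → Fin p)} (hA : SupportedOn S A) :
    SupportedOn S Aᴴ := by
  obtain ⟨a, rfl⟩ := hA
  exact ⟨aᴴ, (extendOp_conjTranspose S a).symm⟩

/-- An operator is supported on `S` if and only if its matrix is diagonal outside `S` and does
not depend on the configuration outside `S`. -/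
theorem supportedOn_iff [NeZero p] {S : Finset Λ} {O : Op (Λ → Fin p)} :
    SupportedOn S O ↔ (∀ x y, O x y ≠ 0 → ∀ i, i ∉ S → x i = y i) ∧
      ∀ x y x' y', (∀ i ∈ S, x i = x' i) → (∀ i ∈ S, y i = y' i) → (∀ i, i ∉ S → x i = y i) →
        (∀ i, i ∉ S → x' i = y' i) → O x y = O x' y' := by
  constructor
  · rintro ⟨A, rfl⟩
    refine ⟨fun x y h => ?_, fun x y x' y' hx hy h h' => ?_⟩
    · by_contra h1
      exact h (by simp only [extendOp, Matrix.of_apply, if_neg h1])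
    · simp only [extendOp, Matrix.of_apply]
      rw [if_pos h, if_pos h', show (fun i : S => x i) = fun i : S => x' i from
        funext fun i => hx i i.2, show (fun i : S => y i) = fun i : S => y' i from
        funext fun i => hy i i.2]
  · rintro ⟨h1, h2⟩
    refine ⟨Matrix.of fun u v => O (joinConfig S u 0) (joinConfig S v 0), ?_⟩
    ext x y
    simp only [extendOp, Matrix.of_apply]
    split_ifs with h
    · exact h2 _ _ _ _ (fun i hi => by simp [hi]) (fun i hi => by simp [hi]) h
        (fun i hi => by simp [hi])
    · by_contra h3
      exact h (h1 x y h3)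

theorem SupportedOn.mono [NeZero p] {S T : Finset Λ} (h : S ⊆ T) {O : Op (Λ → Fin p)}
    (hO : SupportedOn S O) : SupportedOn T O := by
  rw [supportedOn_iff] at hO ⊢
  obtain ⟨h1, h2⟩ := hO
  refine ⟨fun x y hxy i hi => h1 x y hxy i fun hS => hi (h hS), ?_⟩
  intro x y x' y' hx hy hxy hxy'
  -- If `x` and `y` differ outside `S`, then so do `x'` and `y'`, and both matrix entries vanish.
  by_cases hne : ∀ i, i ∉ S → x i = y i
  · refine h2 _ _ _ _ (fun i hi => hx i (h hi)) (fun i hi => hy i (h hi)) hne fun i hi => ?_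
    by_cases hT : i ∈ T
    · rw [← hx i hT, ← hy i hT, hne i hi]
    · exact hxy' i hT
  · have hne' : ¬ ∀ i, i ∉ S → x' i = y' i := fun hc => hne fun i hi => by
      by_cases hT : i ∈ T
      · rw [hx i hT, hy i hT, hc i hi]
      · exact hxy i hT
    rw [show O x y = 0 from by_contra fun hc => hne (h1 x y hc),
      show O x' y' = 0 from by_contra fun hc => hne' (h1 x' y' hc)]

/-- The support property of `extendOp M A` in terms of the matrix `A`. -/
theorem supportedOn_extendOp [NeZero p] {M N : Finset Λ} (hN : N ⊆ M) {A : Op (M → Fin p)}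
    (h : SupportedOn N (extendOp M A)) :
    (∀ u v, A u v ≠ 0 → ∀ i : M, ↑i ∉ N → u i = v i) ∧
      ∀ u v u' v', (∀ i : M, ↑i ∈ N → u i = u' i) → (∀ i : M, ↑i ∈ N → v i = v' i) →
        (∀ i : M, ↑i ∉ N → u i = v i) → (∀ i : M, ↑i ∉ N → u' i = v' i) → A u v = A u' v' := by
  have hA : ∀ u v, A u v = extendOp M A (joinConfig M u 0) (joinConfig M v 0) := fun u v => by
    rw [extendOp_joinConfig, if_pos rfl]
  obtain ⟨h1, h2⟩ := supportedOn_iff.mp h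
  refine ⟨fun u v huv i hi => ?_, fun u v u' v' hu hv huv huv' => ?_⟩
  · have := h1 _ _ (by rw [← hA]; exact huv) i hi
    simpa using this
  · rw [hA, hA]
    refine h2 _ _ _ _ (fun i hi => ?_) (fun i hi => ?_) (fun i hi => ?_) (fun i hi => ?_)
    · simpa [hN hi] using hu ⟨i, hN hi⟩ hi
    · simpa [hN hi] using hv ⟨i, hN hi⟩ hi
    · by_cases hM : i ∈ M
      · simpa [hM] using huv ⟨i, hM⟩ hi
      · simp [hM]
    · by_cases hM : i ∈ M
      · simpa [hM] using huv' ⟨i, hM⟩ hi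
      · simp [hM]

/-! The expansion lemma. -/

/-- All operators supported on `S` are detectable. -/
def IsCorrectable (V : Submodule ℂ ((Λ → Fin p) → ℂ)) (S : Finset Λ) : Prop :=
  ∀ O : Op (Λ → Fin p), SupportedOn S O → IsDetectable V O

/-- The vector `O ψ - c ψ` lies in `V` and is orthogonal to all of `V`, hence to itself. -/
theorem IsDetectable.mulVec_eq_smul {X : Type} [Fintype X] {V : Submodule ℂ (X → ℂ)} {O : Op X}
    (hO : IsDetectable V O) (hV : ∀ ψ ∈ V, O *ᵥ ψ ∈ V) : ∃ c : ℂ, ∀ ψ ∈ V, O *ᵥ ψ = c • ψ := by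
  obtain ⟨c, hc⟩ := hO
  refine ⟨c, fun ψ hψ => ?_⟩
  have hmem : O *ᵥ ψ - c • ψ ∈ V := V.sub_mem (hV ψ hψ) (V.smul_mem c hψ)
  have h := hc _ hmem ψ hψ
  have h0 : star (O *ᵥ ψ - c • ψ) ⬝ᵥ (O *ᵥ ψ - c • ψ) = 0 := by
    rw [dotProduct_sub, dotProduct_smul, h, smul_eq_mul, sub_self]
  exact sub_eq_zero.mp (dotProduct_star_self_eq_zero.mp h0)

/-- Matrix elements between vectors of `V` depend only on the compression `P * O * P`. -/
theorem IsDetectable.congr_compression {X : Type} [Fintype X] [DecidableEq X]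
    {V : Submodule ℂ (X → ℂ)} {P O O' : Op X} (hP : P.IsHermitian) (hfix : ∀ ψ ∈ V, P *ᵥ ψ = ψ)
    (h : P * O * P = P * O' * P) (hO' : IsDetectable V O') : IsDetectable V O := by
  obtain ⟨c, hc⟩ := hO'
  have key : ∀ B : Op X, ∀ ψ ∈ V, ∀ χ ∈ V, star ψ ⬝ᵥ (B *ᵥ χ) = star ψ ⬝ᵥ ((P * B * P) *ᵥ χ) := by
    intro B ψ hψ χ hχ
    rw [← Matrix.mulVec_mulVec, ← Matrix.mulVec_mulVec, hfix χ hχ, Matrix.dotProduct_mulVec (star ψ) P]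
    have h1 : star ψ ᵥ* P = star ψ := by
      conv_lhs => rw [← hP.eq, ← Matrix.star_mulVec, hfix ψ hψ]
    rw [h1]
  refine ⟨c, fun ψ hψ χ hχ => ?_⟩
  rw [key O ψ hψ χ hχ, h, ← key O' ψ hψ χ hχ, hc ψ hψ χ hχ]

theorem opBlock_mem_support [NeZero p] {M N : Finset Λ} (hN : N ⊆ M) {O : Op (Λ → Fin p)}
    (hO : SupportedOn (N ∪ Mᶜ) O) (k k' : {j : Λ // j ∉ M} → Fin p) :
    SupportedOn N (extendOp M (opBlock M O k k')) := by
  obtain ⟨h1, h2⟩ := supportedOn_iff.mp hO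
  rw [supportedOn_iff]
  refine ⟨fun x y hxy i hi => ?_, fun x y x' y' hx hy hxy hxy' => ?_⟩
  · simp only [extendOp, Matrix.of_apply, opBlock] at hxy
    split_ifs at hxy with h
    · by_cases hM : i ∈ M
      · simpa [hM] using h1 _ _ hxy i (by simp [hi, hM])
      · exact h i hM
    · exact absurd rfl hxy
  · simp only [extendOp, Matrix.of_apply, opBlock]
    rw [if_pos fun i hi => hxy i fun h => hi (hN h), if_pos fun i hi => hxy' i fun h => hi (hN h)]
    refine h2 _ _ _ _ (fun i hi => ?_) (fun i hi => ?_) (fun i hi => ?_) (fun i hi => ?_)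
    · by_cases hM : i ∈ M
      · simpa [hM] using hx i (by simpa [hM] using hi)
      · simp [hM]
    · by_cases hM : i ∈ M
      · simpa [hM] using hy i (by simpa [hM] using hi)
      · simp [hM]
    · simp only [Finset.mem_union, Finset.mem_compl, not_or, not_not] at hi
      simpa [hi.2] using hxy i hi.1
    · simp only [Finset.mem_union, Finset.mem_compl, not_or, not_not] at hi
      simpa [hi.2] using hxy' i hi.1

/-- The expansion lemma. An operator on `M ∪ N₂` is replaced block by block, without changing its
compression to `V`, by an operator on `N₁ ∪ N₂`. Correctability of `M` is what makes the replacement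
possible: it forces the relevant commutant to act on `V` by scalars. -/
theorem isCorrectable_union [NeZero p] {τ : Type} {proj : τ → Op (Λ → Fin p)}
    (hH : ∀ a, (proj a).IsHermitian) (hcomm : ∀ a b, proj a * proj b = proj b * proj a)
    {V : Submodule ℂ ((Λ → Fin p) → ℂ)} (hV : ∀ ψ, ψ ∈ V ↔ ∀ a, proj a *ᵥ ψ = ψ)
    {M N₁ N₂ : Finset Λ} (hN₁ : N₁ ⊆ M) (hN₂ : Disjoint M N₂)
    (hloc : ∀ a, SupportedOn M (proj a) ∨ SupportedOn (N₁ ∪ Mᶜ) (proj a))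
    (hM : IsCorrectable V M) (hN : IsCorrectable V (N₁ ∪ N₂)) : IsCorrectable V (M ∪ N₂) := by
  obtain ⟨P, hP, hPmem, hPfix⟩ := exists_isHermitian_projection V
  -- The columns of `P` cut into slices along `M`. Operators on `M` act on these slices, and a
  -- column is labelled by the configuration `k` outside `M` and the column `y` of `P`.
  let Ψ : Matrix (M → Fin p) (({j : Λ // j ∉ M} → Fin p) × (Λ → Fin p)) ℂ :=
    Matrix.of fun u ky => P (joinConfig M u ky.1) ky.2
  have hPcol : ∀ (B : Op (Λ → Fin p)) (c : ℂ), (∀ ψ ∈ V, B *ᵥ ψ = c • ψ) → B * P = c • P := by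
    intro B c hB
    apply Matrix.ext_of_mulVec_single
    intro i
    rw [← Matrix.mulVec_mulVec, hB _ (hPmem _), Matrix.smul_mulVec]
  have hΨmul : ∀ (A : Op (M → Fin p)) (c : ℂ), extendOp M A * P = c • P → A * Ψ = c • Ψ := by
    intro A c h
    ext u ⟨k, y⟩
    have h1 := congrFun (congrFun h (joinConfig M u k)) y
    rw [← joinConfig_restrict M y, extendOp_mul_apply] at h1
    simpa [Matrix.mul_apply, opBlock, Ψ] using h1
  -- The operators on `N₁` that commute with every projection supported in `M`. This algebra
  -- contains the blocks of all projections that reach across the boundary of `M`.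
  let 𝒮 : StarSubalgebra ℂ (Op (M → Fin p)) :=
    { carrier := {S | SupportedOn N₁ (extendOp M S) ∧
        ∀ q : Op (M → Fin p), (∃ a, proj a = extendOp M q) → q * S = S * q}
      mul_mem' := by
        rintro S T ⟨h1, h2⟩ ⟨h3, h4⟩
        refine ⟨by rw [extendOp_mul]; exact h1.mul h3, fun q hq => ?_⟩
        rw [← Matrix.mul_assoc, h2 q hq, Matrix.mul_assoc, h4 q hq, Matrix.mul_assoc]
      add_mem' := by
        rintro S T ⟨h1, h2⟩ ⟨h3, h4⟩
        refine ⟨by rw [extendOp_add]; exact h1.add h3, fun q hq => ?_⟩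
        rw [Matrix.mul_add, h2 q hq, h4 q hq, Matrix.add_mul]
      algebraMap_mem' := by
        intro c
        rw [Algebra.algebraMap_eq_smul_one]
        refine ⟨by rw [extendOp_smul, extendOp_one]; exact (SupportedOn.one N₁).smul c,
          fun q _ => by simp⟩
      star_mem' := by
        rintro S ⟨h1, h2⟩
        refine ⟨by
          rw [Matrix.star_eq_conjTranspose, extendOp_conjTranspose]; exact h1.conjTranspose,
          fun q hq => ?_⟩
        have hqH : qᴴ = q := by
          obtain ⟨a, ha⟩ := hq
          apply extendOp_injective M
          rw [extendOp_conjTranspose, ← ha, (hH a).eq]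
        have h3 := congrArg Matrix.conjTranspose (h2 q hq)
        rw [Matrix.conjTranspose_mul, Matrix.conjTranspose_mul, hqH] at h3
        exact h3.symm }
  have hblock : ∀ a, SupportedOn (N₁ ∪ Mᶜ) (proj a) → ∀ k k', opBlock M (proj a) k k' ∈ 𝒮 := by
    intro a ha k k'
    refine ⟨opBlock_mem_support hN₁ ha k k', ?_⟩
    rintro q ⟨b, hb⟩
    ext u u'
    rw [← extendOp_mul_apply, ← mul_extendOp_apply, ← hb, hcomm]
  have hscalar : ∀ Z : Op (M → Fin p), (∀ S ∈ 𝒮, S * Z = Z * S) →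
      (∀ Q : Op (M → Fin p), (∀ S ∈ 𝒮, Q * S = S * Q) → Q * Ψ = Ψ → Q * Z = Z) →
      ∃ z : ℂ, Z * Ψ = z • Ψ := by
    intro Z hZ hQ
    have hinv : ∀ ψ ∈ V, extendOp M Z *ᵥ ψ ∈ V := by
      intro ψ hψ
      rw [hV]
      intro a
      rw [Matrix.mulVec_mulVec]
      -- A projection inside `M` lies in the commutant of `𝒮` and fixes `Ψ`, so it absorbs `Z`. A
      -- projection on `N₁ ∪ Mᶜ` has its blocks in `𝒮`, so it commutes with `Z`. In both cases `Z`
      -- preserves `V`.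
      rcases hloc a with h | h
      · obtain ⟨q, hq⟩ := h
        have h1 : q * Z = Z := by
          refine hQ q (fun S hS => hS.2 q ⟨a, hq⟩) ?_
          simpa using hΨmul q 1 (hPcol _ 1 fun χ hχ => by
            rw [one_smul, ← hq]; exact (hV χ).mp hχ a)
        rw [hq, ← extendOp_mul, h1]
      · have h1 : proj a * extendOp M Z = extendOp M Z * proj a := by
          apply ext_joinConfig M
          intro u k u' k'
          rw [mul_extendOp_apply, extendOp_mul_apply, hZ _ (hblock a h k k')]
        rw [h1, ← Matrix.mulVec_mulVec, (hV ψ).mp hψ a]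
    obtain ⟨z, hz⟩ := (hM _ ⟨Z, rfl⟩).mulVec_eq_smul hinv
    exact ⟨z, hΨmul Z z (hPcol _ z hz)⟩
  choose σ hσ hσΨ using exists_mem_compression_eq 𝒮 Ψ hscalar
  intro O hO
  obtain ⟨hO1, hO2⟩ := supportedOn_iff.mp hO
  -- Each block of `O` is replaced by an element of `𝒮` with the same compression. As `σ` is a
  -- function of the block, `O'` does not depend on the configuration outside `M ∪ N₂`, just as `O`
  -- does not.
  let O' : Op (Λ → Fin p) := Matrix.of fun x y =>
    if ∀ i, i ∉ M ∪ N₂ → x i = y i then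
      σ (opBlock M O (fun i => x i) (fun i => y i)) (fun i => x i) (fun i => y i) else 0
  have hdisj : ∀ i ∈ M, i ∉ N₂ := fun i hi hi' => Finset.disjoint_left.mp hN₂ hi hi'
  have hO' : SupportedOn (N₁ ∪ N₂) O' := by
    rw [supportedOn_iff]
    refine ⟨fun x y hxy i hi => ?_, fun x y x' y' hx hy hxy hxy' => ?_⟩
    · simp only [O', Matrix.of_apply] at hxy
      rw [Finset.mem_union, not_or] at hi
      split_ifs at hxy with h
      · by_cases hiM : i ∈ M
        · exact (supportedOn_extendOp hN₁ (hσ _).1).1 _ _ hxy ⟨i, hiM⟩ hi.1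
        · exact h i (by simp [hiM, hi.2])
      · exact absurd rfl hxy
    · have hsub : ∀ i, i ∉ M ∪ N₂ → i ∉ N₁ ∪ N₂ := by
        intro i hi h
        rw [Finset.mem_union] at h hi
        exact hi (h.imp (fun h => hN₁ h) id)
      simp only [O', Matrix.of_apply]
      rw [if_pos fun i hi => hxy i (hsub i hi), if_pos fun i hi => hxy' i (hsub i hi)]
      have hb : opBlock M O (fun i => x i) (fun i => y i)
          = opBlock M O (fun i => x' i) (fun i => y' i) := by
        ext u v
        refine hO2 _ _ _ _ (fun i hi => ?_) (fun i hi => ?_) (fun i hi => ?_) (fun i hi => ?_)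
        · by_cases hiM : i ∈ M
          · simp [hiM]
          · have : i ∈ N₂ := by simpa [hiM] using hi
            simpa [hiM] using hx i (by simp [this])
        · by_cases hiM : i ∈ M
          · simp [hiM]
          · have : i ∈ N₂ := by simpa [hiM] using hi
            simpa [hiM] using hy i (by simp [this])
        · have hiM : i ∉ M := fun h => hi (by simp [h])
          simpa [hiM] using hxy i (hsub i hi)
        · have hiM : i ∉ M := fun h => hi (by simp [h])
          simpa [hiM] using hxy' i (hsub i hi)
      rw [hb]
      refine (supportedOn_extendOp hN₁ (hσ _).1).2 _ _ _ _ (fun i hi => hx i (by simp [hi]))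
        (fun i hi => hy i (by simp [hi])) (fun i hi => hxy i ?_) (fun i hi => hxy' i ?_)
      · simp [hi, hdisj i i.2]
      · simp [hi, hdisj i i.2]
  have hcompr : ∀ B : Op (Λ → Fin p), ∀ y y', (P * B * P) y y'
      = ∑ k, ∑ k', (Ψᴴ * opBlock M B k k' * Ψ) (k, y) (k', y') := by
    intro B y y'
    have hPe : ∀ x, P y x = star (P x y) := fun x => (hP.apply y x).symm
    simp only [Matrix.mul_apply, Finset.sum_mul, Matrix.conjTranspose_apply, Ψ, Matrix.of_apply,
      opBlock, hPe]
    calc _ = ∑ u', ∑ k', ∑ k, ∑ u, star (P (joinConfig M u k) y)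
          * B (joinConfig M u k) (joinConfig M u' k') * P (joinConfig M u' k') y' := by
          rw [sum_joinConfig M]
          refine Finset.sum_congr rfl fun u' _ => Finset.sum_congr rfl fun k' _ => ?_
          rw [sum_joinConfig M, Finset.sum_comm]
      _ = _ := by
          rw [Finset.sum_comm]
          conv_rhs => rw [Finset.sum_comm]
          exact Finset.sum_congr rfl fun k' _ => Finset.sum_comm
  refine IsDetectable.congr_compression hP hPfix ?_ (hN O' hO')
  ext y y'
  rw [hcompr, hcompr]
  refine Finset.sum_congr rfl fun k _ => Finset.sum_congr rfl fun k' _ => ?_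
  -- Blocks whose labels differ outside `M ∪ N₂` vanish for both operators.
  by_cases hk : ∀ i, ∀ hi : i ∉ M, i ∉ N₂ → k ⟨i, hi⟩ = k' ⟨i, hi⟩
  · have h1 : opBlock M O' k k' = σ (opBlock M O k k') := by
      ext u u'
      simp only [opBlock, O', Matrix.of_apply, restrict_joinConfig, restrict_compl_joinConfig]
      rw [if_pos]
      intro i hi
      rw [Finset.mem_union, not_or] at hi
      simpa [hi.1] using hk i hi.1 hi.2
    rw [h1, hσΨ]
  · have hne : ∀ u u', ¬ ∀ i, i ∉ M ∪ N₂ → joinConfig M u k i = joinConfig M u' k' i := by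
      intro u u' h
      refine hk fun i hi hi' => ?_
      simpa [hi] using h i (by simp [hi, hi'])
    have h1 : opBlock M O' k k' = 0 := by
      ext u u'
      simp only [opBlock, O', Matrix.of_apply]
      rw [if_neg (hne u u')]
      rfl
    have h2 : opBlock M O k k' = 0 := by
      ext u u'
      by_contra h
      exact hne u u' (hO1 _ _ h)
    rw [h1, h2]

end Regions

/-! Logical operators on the complement of a correctable region. -/

section Distinguish

variable {Λ : Type} [Fintype Λ] [DecidableEq Λ] {p : ℕ}

theorem extendOp_mulVec_joinConfig (S : Finset Λ) (A : Op (S → Fin p)) (ψ : (Λ → Fin p) → ℂ)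
    (u : S → Fin p) (k : {j : Λ // j ∉ S} → Fin p) :
    (extendOp S A *ᵥ ψ) (joinConfig S u k) = (A *ᵥ fun u' => ψ (joinConfig S u' k)) u := by
  simp only [Matrix.mulVec, dotProduct]
  rw [sum_joinConfig S]
  simp [extendOp_joinConfig]

/-- The slices outside a region `Sᶜ` of orthogonal code vectors are orthogonal if `Sᶜ` is
correctable. -/
theorem slices_orthogonal [NeZero p] {V : Submodule ℂ ((Λ → Fin p) → ℂ)} {S : Finset Λ}
    (hS : IsCorrectable V Sᶜ) {ψ₀ ψ₁ : (Λ → Fin p) → ℂ} (h₀ : ψ₀ ∈ V) (h₁ : ψ₁ ∈ V)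
    (horth : star ψ₀ ⬝ᵥ ψ₁ = 0) (k k' : {j : Λ // j ∉ S} → Fin p) :
    ∑ u : S → Fin p, star (ψ₀ (joinConfig S u k)) * ψ₁ (joinConfig S u k') = 0 := by
  -- The matrix unit `|k⟩⟨k'|` on `Sᶜ`. Its matrix element between `ψ₀` and `ψ₁` is the sum in
  -- question, and detectability makes it a multiple of `⟨ψ₀, ψ₁⟩`.
  let X : Op (Λ → Fin p) := Matrix.of fun x y =>
    if (fun i : S => x i) = (fun i : S => y i) ∧ (fun i : {j : Λ // j ∉ S} => x i) = k ∧
      (fun i : {j : Λ // j ∉ S} => y i) = k' then 1 else 0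
  have hX : SupportedOn Sᶜ X := by
    rw [supportedOn_iff]
    refine ⟨fun x y hxy i hi => ?_, fun x y x' y' hx hy hxy hxy' => ?_⟩
    · simp only [X, Matrix.of_apply] at hxy
      split_ifs at hxy with h
      · exact congrFun h.1 ⟨i, by simpa using hi⟩
      · exact absurd rfl hxy
    · simp only [X, Matrix.of_apply]
      rw [show (fun i : {j : Λ // j ∉ S} => x i) = fun i : {j : Λ // j ∉ S} => x' i from
        funext fun i => hx i (by simpa using i.2),
        show (fun i : {j : Λ // j ∉ S} => y i) = fun i : {j : Λ // j ∉ S} => y' i from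
        funext fun i => hy i (by simpa using i.2),
        show (fun i : S => x i) = fun i : S => y i from funext fun i => hxy i (by simp),
        show (fun i : S => x' i) = fun i : S => y' i from funext fun i => hxy' i (by simp)]
      simp
  obtain ⟨c, hc⟩ := hS X hX
  have h := hc ψ₀ h₀ ψ₁ h₁
  rw [horth, mul_zero] at h
  rw [← h]
  simp only [dotProduct, Matrix.mulVec, Pi.star_apply]
  rw [sum_joinConfig S]
  refine Finset.sum_congr rfl fun u _ => ?_
  symm
  rw [Finset.sum_eq_single k]
  · congr 1
    rw [sum_joinConfig S, Finset.sum_eq_single u, Finset.sum_eq_single k']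
    · simp [X, restrict_compl_joinConfig]
    · intro l _ hl
      simp [X, restrict_compl_joinConfig, hl]
    · simp
    · intro u' _ hu
      simp [X, restrict_compl_joinConfig, hu.symm]
    · simp
  · intro l _ hl
    rw [Finset.sum_eq_zero, mul_zero]
    intro y _
    simp [X, restrict_compl_joinConfig, hl]
  · simp

/-- Orthogonal code vectors are distinguished by a measurement outside a correctable region. -/
theorem exists_distinguishing_op [NeZero p] {V : Submodule ℂ ((Λ → Fin p) → ℂ)} {S : Finset Λ}
    (hS : IsCorrectable V Sᶜ) {ψ₀ ψ₁ : (Λ → Fin p) → ℂ} (h₀ : ψ₀ ∈ V) (h₁ : ψ₁ ∈ V)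
    (horth : star ψ₀ ⬝ᵥ ψ₁ = 0) :
    ∃ O : Op (Λ → Fin p), O.IsHermitian ∧ O * O = 1 ∧ SupportedOn S O ∧
      O *ᵥ ψ₀ = ψ₀ ∧ O *ᵥ ψ₁ = -ψ₁ := by
  let W : Submodule ℂ ((S → Fin p) → ℂ) :=
    Submodule.span ℂ (Set.range fun k u => ψ₀ (joinConfig S u k))
  obtain ⟨w, hw, hmem, hfix⟩ := exists_isHermitian_projection W
  have hww : w * w = w := by
    apply Matrix.ext_of_mulVec_single
    intro i
    rw [← Matrix.mulVec_mulVec, hfix _ (hmem _)]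
  -- The reflection that is `+1` on the span of the slices of `ψ₀` and `-1` on its orthogonal
  -- complement, where all slices of `ψ₁` lie.
  let A : Op (S → Fin p) := (2 : ℂ) • w - 1
  have hA : Aᴴ = A := by
    simp only [A, Matrix.conjTranspose_sub, Matrix.conjTranspose_smul, hw.eq,
      Matrix.conjTranspose_one]
    simp
  have hAA : A * A = 1 := by
    simp only [A, Matrix.sub_mul, Matrix.mul_sub, Matrix.smul_mul, Matrix.mul_smul, hww,
      Matrix.one_mul, Matrix.mul_one]
    module
  have hvec : ∀ (c : ℂ) (ψ : (Λ → Fin p) → ℂ),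
      (∀ k, (w *ᵥ fun u => ψ (joinConfig S u k)) = c • fun u => ψ (joinConfig S u k)) →
      extendOp S A *ᵥ ψ = (2 * c - 1) • ψ := by
    intro c ψ h
    ext x
    rw [← joinConfig_restrict S x, extendOp_mulVec_joinConfig]
    simp only [A, Matrix.sub_mulVec, Matrix.smul_mulVec, Matrix.one_mulVec, h]
    simp only [Pi.sub_apply, Pi.smul_apply, smul_eq_mul]
    ring
  refine ⟨extendOp S A, ?_, ?_, ⟨A, rfl⟩, ?_, ?_⟩
  · rw [Matrix.IsHermitian, ← extendOp_conjTranspose, hA]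
  · rw [← extendOp_mul, hAA, extendOp_one]
  · rw [hvec 1 ψ₀]
    · norm_num
    · intro k
      rw [one_smul]
      exact hfix _ (Submodule.subset_span ⟨k, rfl⟩)
  · rw [hvec 0 ψ₁]
    · norm_num
    · intro k
      rw [zero_smul]
      have h1 : ∀ v ∈ W, star v ⬝ᵥ (fun u => ψ₁ (joinConfig S u k)) = 0 := by
        intro v hv
        induction hv using Submodule.span_induction with
        | mem v hv =>
          obtain ⟨l, rfl⟩ := hv
          exact slices_orthogonal hS h₀ h₁ horth l k
        | zero => simp
        | add v v' _ _ h h' => rw [star_add, add_dotProduct, h, h', add_zero]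
        | smul c v _ h => rw [star_smul, smul_dotProduct, h, smul_zero]
      apply dotProduct_star_self_eq_zero.mp
      rw [Matrix.star_mulVec, hw.eq, ← Matrix.dotProduct_mulVec, Matrix.mulVec_mulVec, hww,
        Matrix.dotProduct_mulVec]
      have h2 := h1 _ (hmem fun u => ψ₁ (joinConfig S u k))
      rwa [Matrix.star_mulVec, hw.eq] at h2

end Distinguish

/-- A code space of dimension at most one has no undetectable operator. Thus the existence of a
distance excludes `A = ∅`. -/
theorem isDetectable_of_le_span_singleton {X : Type} [Fintype X] {V : Submodule ℂ (X → ℂ)}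
    {v : X → ℂ} (h : V ≤ Submodule.span ℂ {v}) (O : Op X) : IsDetectable V O := by
  by_cases hv : star v ⬝ᵥ v = 0
  · have hv0 : v = 0 := dotProduct_star_self_eq_zero.mp hv
    refine ⟨0, fun ψ hψ χ hχ => ?_⟩
    have := h hχ
    rw [hv0, Submodule.span_singleton_eq_bot.mpr rfl, Submodule.mem_bot] at this
    simp [this]
  · refine ⟨(star v ⬝ᵥ (O *ᵥ v)) / (star v ⬝ᵥ v), fun ψ hψ χ hχ => ?_⟩
    obtain ⟨a, rfl⟩ := Submodule.mem_span_singleton.mp (h hψ)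
    obtain ⟨b, rfl⟩ := Submodule.mem_span_singleton.mp (h hχ)
    simp only [star_smul, smul_dotProduct, Matrix.mulVec_smul, dotProduct_smul, smul_eq_mul]
    field_simp

/-! Pure states and the effect of a local channel. -/

section Evolution

theorem trace_vecMulVec_star_mul {X : Type} [Fintype X] (ψ : X → ℂ) (O : Op X) :
    (Matrix.vecMulVec ψ (star ψ) * O).trace = star ψ ⬝ᵥ (O *ᵥ ψ) := by
  rw [Matrix.vecMulVec_mul, Matrix.trace_vecMulVec, dotProduct_comm, Matrix.dotProduct_mulVec]

theorem conjTranspose_vecMulVec_star {X : Type} (ψ : X → ℂ) :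
    (Matrix.vecMulVec ψ (star ψ))ᴴ = Matrix.vecMulVec ψ (star ψ) := by
  rw [Matrix.conjTranspose_vecMulVec, star_star]

theorem norm_expectation_le_opNorm {X : Type} [Fintype X] [DecidableEq X] {ψ : X → ℂ}
    (hψ : star ψ ⬝ᵥ ψ = 1) (O : Op X) : ‖star ψ ⬝ᵥ (O *ᵥ ψ)‖ ≤ opNorm O := by
  let T := Matrix.toEuclideanCLM (n := X) (𝕜 := ℂ)
  have h1 : ∀ χ : X → ℂ, inner ℂ (WithLp.toLp 2 ψ) (WithLp.toLp 2 χ) = star ψ ⬝ᵥ χ := by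
    intro χ
    rw [EuclideanSpace.inner_eq_star_dotProduct, dotProduct_comm]
  have h2 : ‖WithLp.toLp 2 ψ‖ = 1 := by
    have h3 := h1 ψ
    rw [hψ, inner_self_eq_norm_sq_to_K] at h3
    have h4 : ‖WithLp.toLp 2 ψ‖ ^ 2 = 1 := by
      apply Complex.ofReal_injective
      simpa using h3
    nlinarith [norm_nonneg (WithLp.toLp 2 ψ)]
  rw [← h1, ← Matrix.toEuclideanCLM_toLp]
  refine (norm_inner_le_norm _ _).trans ?_
  rw [h2, one_mul]
  refine (ContinuousLinearMap.le_opNorm _ _).trans ?_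
  rw [h2, mul_one]
  exact le_rfl

theorem norm_trace_conjTranspose_mul_le {X : Type} [Fintype X] [DecidableEq X] {O : Op X}
    (hO : O.IsHermitian) (h : O * O = 1) (N : Op X) : ‖(Nᴴ * O).trace‖ ≤ traceNorm N := by
  have h1 : (Nᴴ * O).trace = star (O * N).trace := by
    rw [← Matrix.trace_conjTranspose, Matrix.conjTranspose_mul, hO.eq]
  rw [h1, norm_star]
  refine (norm_trace_mul_le_opNorm_mul_traceNorm O N).trans ?_
  refine mul_le_of_le_one_left ?_ (opNorm_le_one_of_isHermitian_of_sq_eq_one hO h)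
  exact Finset.sum_nonneg fun i _ => Real.sqrt_nonneg _

theorem isStateOn_vecMulVec {X : Type} [Fintype X] {V : Submodule ℂ (X → ℂ)} {ψ : X → ℂ}
    (hψ : ψ ∈ V) (h1 : star ψ ⬝ᵥ ψ = 1) : IsStateOn V (Matrix.vecMulVec ψ (star ψ)) := by
  refine ⟨Matrix.posSemidef_vecMulVec_self_star ψ, ?_, fun χ => ?_⟩
  · rw [Matrix.trace_vecMulVec, dotProduct_comm, h1]
  · rw [Matrix.vecMulVec_mulVec, op_smul_eq_smul]
    exact V.smul_mem _ hψ

variable {Λ : Type} [Fintype Λ] [DecidableEq Λ] {p : ℕ}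

/-- The expectation values of operators on `S` after a channel on `S` do not change when basis
labels outside `S` are permuted. -/
theorem trace_hsAdjoint_extendMap_submatrix {S : Finset Λ} {π : Λ → Equiv.Perm (Fin p)}
    (hπ : ∀ i ∈ S, π i = 1) (F : SuperOp (S → Fin p)) {O : Op (Λ → Fin p)}
    (hO : SupportedOn S O) (N : Op (Λ → Fin p)) :
    ((N.submatrix (Equiv.piCongrRight π) (Equiv.piCongrRight π))ᴴ
      * hsAdjoint (extendMap S F) O).trace = (Nᴴ * hsAdjoint (extendMap S F) O).trace := by
  rw [trace_conjTranspose_mul_hsAdjoint, trace_conjTranspose_mul_hsAdjoint]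
  set e := Equiv.piCongrRight π
  have hres : ∀ x : Λ → Fin p, (fun i : S => e x i) = fun i : S => x i := by
    intro x
    ext i
    simp [e, hπ i i.2]
  have hglue : ∀ (u : S → Fin p) (x : Λ → Fin p), glue S u (e x) = e (glue S u x) := by
    intro u x
    ext i
    by_cases h : i ∈ S <;> simp [glue, e, h, hπ]
  -- The relabelling acts outside `S` only, so it commutes with `F ⊗ id` and leaves `O` unchanged.
  have h1 : extendMap S F (N.submatrix e e) = (extendMap S F N).submatrix e e := by
    ext x y
    simp only [extendMap, LinearMap.coe_mk, AddHom.coe_mk, Matrix.of_apply,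
      Matrix.submatrix_apply, hres, hglue]
  have h2 : O = O.submatrix e e := by
    obtain ⟨A, rfl⟩ := hO
    ext x y
    simp only [extendOp, Matrix.of_apply, Matrix.submatrix_apply, hres]
    simp [e]
  conv_lhs => rw [h1, h2, Matrix.conjTranspose_submatrix, Matrix.submatrix_mul_equiv]
  simp only [Matrix.trace, Matrix.diag, Matrix.submatrix_apply]
  exact Equiv.sum_comp e fun x => ((extendMap S F N)ᴴ * O) x x

/-- If `E` encodes two orthogonal vectors that differ only outside `S`, and the encoded vectors
can be distinguished on `S`, then `E` is not close to a map on `S`. -/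
theorem one_sub_le_opNorm_of_distinguishable {S : Finset Λ} {π : Λ → Equiv.Perm (Fin p)}
    (hπ : ∀ i ∈ S, π i = 1) {E : SuperOp (Λ → Fin p)} (F : SuperOp (S → Fin p))
    {U O : Op (Λ → Fin p)} {ε : ℝ} {ψ : (Λ → Fin p) → ℂ}
    (hO : O.IsHermitian) (hOO : O * O = 1) (hOS : SupportedOn S O)
    (hUψ : star (U *ᵥ ψ) ⬝ᵥ (U *ᵥ ψ) = 1)
    (hUψ' : star (U *ᵥ (ψ ∘ Equiv.piCongrRight π)) ⬝ᵥ (U *ᵥ (ψ ∘ Equiv.piCongrRight π)) = 1)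
    (hψ : star ψ ⬝ᵥ ψ = 1)
    (hψ' : star (ψ ∘ Equiv.piCongrRight π) ⬝ᵥ (ψ ∘ Equiv.piCongrRight π) = 1)
    (h₀ : O *ᵥ (U *ᵥ ψ) = U *ᵥ ψ)
    (h₁ : O *ᵥ (U *ᵥ (ψ ∘ Equiv.piCongrRight π)) = -(U *ᵥ (ψ ∘ Equiv.piCongrRight π)))
    (hE₀ : traceNorm (E (Matrix.vecMulVec ψ (star ψ))
      - U * Matrix.vecMulVec ψ (star ψ) * Uᴴ) ≤ ε)
    (hE₁ : traceNorm (E (Matrix.vecMulVec (ψ ∘ Equiv.piCongrRight π)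
      (star (ψ ∘ Equiv.piCongrRight π))) - U * Matrix.vecMulVec (ψ ∘ Equiv.piCongrRight π)
      (star (ψ ∘ Equiv.piCongrRight π)) * Uᴴ) ≤ ε) :
    1 - ε ≤ opNorm (hsAdjoint E O - hsAdjoint (extendMap S F) O) := by
  set χ := ψ ∘ Equiv.piCongrRight π with hχ
  set δ := opNorm (hsAdjoint E O - hsAdjoint (extendMap S F) O)
  have hsub : Matrix.vecMulVec χ (star χ)
      = (Matrix.vecMulVec ψ (star ψ)).submatrix (Equiv.piCongrRight π) (Equiv.piCongrRight π) := by
    ext x y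
    rfl
  have hF := trace_hsAdjoint_extendMap_submatrix hπ F hOS (Matrix.vecMulVec ψ (star ψ))
  rw [← hsub] at hF
  have hconj : ∀ η : (Λ → Fin p) → ℂ, U * Matrix.vecMulVec η (star η) * Uᴴ
      = Matrix.vecMulVec (U *ᵥ η) (star (U *ᵥ η)) := by
    intro η
    rw [Matrix.mul_vecMulVec, Matrix.vecMulVec_mul, Matrix.star_mulVec]
  -- If `O` has the value `s` on the encoded vector, the local channel reproduces `s` up to `ε + δ`:
  -- `ε` is the encoding error, through Hölder's inequality, and `δ` is the localization error.
  have hpart : ∀ η : (Λ → Fin p) → ℂ, ∀ s : ℂ, O *ᵥ (U *ᵥ η) = s • (U *ᵥ η) →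
      star (U *ᵥ η) ⬝ᵥ (U *ᵥ η) = 1 → star η ⬝ᵥ η = 1 →
      traceNorm (E (Matrix.vecMulVec η (star η)) - U * Matrix.vecMulVec η (star η) * Uᴴ) ≤ ε →
      ‖((Matrix.vecMulVec η (star η))ᴴ * hsAdjoint (extendMap S F) O).trace - s‖ ≤ ε + δ := by
    intro η s hs hUη hη hε
    have h1 := (norm_trace_conjTranspose_mul_le hO hOO _).trans hε
    have h2 := norm_expectation_le_opNorm hη (hsAdjoint E O - hsAdjoint (extendMap S F) O)
    rw [← trace_vecMulVec_star_mul, Matrix.mul_sub, Matrix.trace_sub] at h2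
    rw [hconj, Matrix.conjTranspose_sub, Matrix.sub_mul, Matrix.trace_sub,
      conjTranspose_vecMulVec_star, trace_vecMulVec_star_mul, hs, dotProduct_smul, hUη,
      smul_eq_mul, mul_one, ← trace_conjTranspose_mul_hsAdjoint,
      conjTranspose_vecMulVec_star] at h1
    rw [conjTranspose_vecMulVec_star]
    calc _ = ‖(Matrix.vecMulVec η (star η) * hsAdjoint E O).trace - s
          - ((Matrix.vecMulVec η (star η) * hsAdjoint E O).trace
            - (Matrix.vecMulVec η (star η) * hsAdjoint (extendMap S F) O).trace)‖ := by
          congr 1; ring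
      _ ≤ _ := (norm_sub_le _ _).trans (add_le_add h1 h2)
  have h2 := hpart ψ 1 (by rw [one_smul, h₀]) hUψ hψ hE₀
  have h3 := hpart χ (-1) (by rw [neg_one_smul, h₁]) hUψ' hψ' hE₁
  rw [hF] at h3
  set z := ((Matrix.vecMulVec ψ (star ψ))ᴴ * hsAdjoint (extendMap S F) O).trace
  -- The same number `z` approximates both `1` and `-1`.
  have h4 : ‖(2 : ℂ)‖ ≤ (ε + δ) + (ε + δ) := by
    calc ‖(2 : ℂ)‖ = ‖(z - -1) - (z - 1)‖ := by congr 1; ring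
      _ ≤ _ := (norm_sub_le _ _).trans (add_le_add h3 h2)
  rw [Complex.norm_ofNat] at h4
  linarith

/-! Unencoded vectors. -/

theorem tensorProductState_inner {A : Finset Λ} {φ : {j : Λ // j ∉ A} → EuclideanSpace ℂ (Fin p)}
    (hφ : ∀ j, ‖φ j‖ = 1) (χ χ' : (A → Fin p) → ℂ) :
    star (tensorProductState A φ χ) ⬝ᵥ tensorProductState A φ χ' = star χ ⬝ᵥ χ' := by
  have h1 : ∀ j, ∑ s, star (φ j s) * φ j s = 1 := by
    intro j
    have h2 : inner ℂ (φ j) (φ j) = (1 : ℂ) := by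
      rw [inner_self_eq_norm_sq_to_K, hφ j]
      simp
    rw [← h2, PiLp.inner_apply]
    exact Finset.sum_congr rfl fun s _ => mul_comm _ _
  have h3 : ∑ k : {j : Λ // j ∉ A} → Fin p, (∏ j, star (φ j (k j))) * ∏ j, φ j (k j) = 1 := by
    simp_rw [← Finset.prod_mul_distrib]
    rw [← Fintype.piFinset_univ,
      ← Finset.prod_univ_sum (fun _ => Finset.univ) fun j s => star (φ j s) * φ j s]
    exact Finset.prod_eq_one fun j _ => h1 j
  simp only [dotProduct, Pi.star_apply, tensorProductState, LinearMap.coe_mk, AddHom.coe_mk]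
  rw [sum_joinConfig A]
  refine Finset.sum_congr rfl fun u _ => ?_
  conv_rhs => rw [← mul_one (star (χ u) * χ' u), ← h3, Finset.mul_sum]
  refine Finset.sum_congr rfl fun k _ => ?_
  have h4 : ∀ j : {j : Λ // j ∉ A}, joinConfig A u k j = k j := fun j => by simp [j.2]
  simp only [restrict_joinConfig, h4, star_mul', star_prod]
  ring

end Evolution

/-! Balls in the lattice. -/

namespace BoxLattice

variable {D : ℕ} (G : BoxLattice D)

theorem coordDist_triangle (i : Fin D) (a b c : Fin (G.side i)) :
    G.coordDist i a c ≤ G.coordDist i a b + G.coordDist i b c := by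
  have := a.2
  have := b.2
  have := c.2
  unfold coordDist Nat.dist
  split_ifs <;> omega

theorem coordDist_self (i : Fin D) (a : Fin (G.side i)) : G.coordDist i a a = 0 := by
  unfold coordDist Nat.dist
  split_ifs <;> omega

theorem siteDist_triangle (x y z : G.Site) :
    G.siteDist x z ≤ G.siteDist x y + G.siteDist y z := by
  refine Finset.sup_le fun i _ => (G.coordDist_triangle i (x i) (y i) (z i)).trans ?_
  exact add_le_add (Finset.le_sup (f := fun i => G.coordDist i (x i) (y i)) (Finset.mem_univ i))
    (Finset.le_sup (f := fun i => G.coordDist i (y i) (z i)) (Finset.mem_univ i))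

theorem siteDist_self (x : G.Site) : G.siteDist x x = 0 := by
  simp [siteDist, coordDist_self]

theorem coordDist_le_siteDist (x y : G.Site) (i : Fin D) :
    G.coordDist i (x i) (y i) ≤ G.siteDist x y :=
  Finset.le_sup (f := fun i => G.coordDist i (x i) (y i)) (Finset.mem_univ i)

/-- At most two points have a given distance from `a` along one direction. -/
theorem card_filter_coordDist_mem_le (i : Fin D) (a : Fin (G.side i)) (T : Finset ℕ) :
    (Finset.univ.filter fun b => G.coordDist i a b ∈ T).card ≤ 2 * T.card := by
  have h : (Finset.univ.filter fun b => G.coordDist i a b ∈ T).card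
      ≤ ((Finset.univ : Finset Bool) ×ˢ T).card := by
    refine Finset.card_le_card_of_injOn (fun b : Fin (G.side i) =>
      -- The Boolean records whether `b` is reached from `a` in the increasing direction, directly
      -- or around the period.
      (decide ((b : ℕ) = a + G.coordDist i a b ∨ (b : ℕ) + G.side i = a + G.coordDist i a b),
        G.coordDist i a b)) ?_ ?_
    · intro b hb
      exact Finset.mem_coe.mpr
        (Finset.mem_product.mpr ⟨Finset.mem_univ _, (Finset.mem_filter.mp hb).2⟩)
    · intro b _ b' _ hbb
      simp only [Prod.mk.injEq, decide_eq_decide] at hbb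
      obtain ⟨h1, h2⟩ := hbb
      have := a.2
      have := b.2
      have := b'.2
      ext
      rw [h2] at h1
      unfold coordDist Nat.dist at h1 h2
      split_ifs at h1 h2 <;> omega
  simpa using h

/-- The ball of radius `R` around `a`. -/
def ball (a : G.Site) (R : ℕ) : Finset G.Site :=
  Finset.univ.filter fun x => G.siteDist a x ≤ R

@[simp] theorem mem_ball {a x : G.Site} {R : ℕ} : x ∈ G.ball a R ↔ G.siteDist a x ≤ R := by
  simp [ball]

/-- The sites whose distance from `a` is in `(R - ξ, R + 1]`. -/
def layer (ξ : ℕ) (a : G.Site) (R : ℕ) : Finset G.Site :=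
  Finset.univ.filter fun x => R < G.siteDist a x + ξ ∧ G.siteDist a x ≤ R + 1

/-- Some coordinate attains the maximum and has at most `ξ + 1` possible distances from `a`. Each of
the other `D - 1` coordinates has at most `R + 2`. Each distance is attained at most twice, and
there are `D` choices of the maximal coordinate. -/
theorem card_layer_le (hD : 0 < D) (ξ : ℕ) (a : G.Site) (R : ℕ) :
    (G.layer ξ a R).card ≤ 2 * D * (ξ + 1) * (2 * (R + 2)) ^ (D - 1) := by
  let T : Fin D → Fin D → Finset ℕ := fun i j =>
    if j = i then Finset.Icc (R + 1 - ξ) (R + 1) else Finset.range (R + 2)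
  let B : Fin D → Finset G.Site := fun i =>
    Fintype.piFinset fun j => Finset.univ.filter fun b => G.coordDist j (a j) b ∈ T i j
  have hsub : G.layer ξ a R ⊆ Finset.univ.biUnion B := by
    intro x hx
    simp only [layer, Finset.mem_filter, Finset.mem_univ, true_and] at hx
    have : Nonempty (Fin D) := ⟨⟨0, hD⟩⟩
    obtain ⟨i, -, hi⟩ := Finset.exists_mem_eq_sup Finset.univ Finset.univ_nonempty
      fun i => G.coordDist i (a i) (x i)
    have hi' : G.siteDist a x = G.coordDist i (a i) (x i) := hi
    simp only [Finset.mem_biUnion, Finset.mem_univ, true_and, B, Fintype.mem_piFinset,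
      Finset.mem_filter, T]
    refine ⟨i, fun j => ?_⟩
    have hj := G.coordDist_le_siteDist a x j
    split_ifs with h
    · subst h
      rw [Finset.mem_Icc]
      omega
    · rw [Finset.mem_range]
      omega
  have hB : ∀ i, (B i).card ≤ 2 * (ξ + 1) * (2 * (R + 2)) ^ (D - 1) := by
    intro i
    rw [Fintype.card_piFinset, ← Finset.mul_prod_erase Finset.univ _ (Finset.mem_univ i)]
    refine Nat.mul_le_mul ?_ ?_
    · refine (G.card_filter_coordDist_mem_le i (a i) _).trans (Nat.mul_le_mul_left 2 ?_)
      simp only [T, if_true, Nat.card_Icc]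
      omega
    · refine (Finset.prod_le_pow_card _ _ (2 * (R + 2)) fun j hj => ?_).trans ?_
      · refine (G.card_filter_coordDist_mem_le j (a j) _).trans (Nat.mul_le_mul_left 2 ?_)
        simp [T, Finset.ne_of_mem_erase hj]
      · simp [Finset.card_erase_of_mem]
  refine (Finset.card_le_card hsub).trans (Finset.card_biUnion_le.trans ?_)
  refine (Finset.sum_le_card_nsmul _ _ _ fun i _ => hB i).trans ?_
  simp only [Finset.card_univ, Fintype.card_fin, smul_eq_mul]
  exact le_of_eq (by ring)

theorem ball_zero (a : G.Site) : G.ball a 0 = {a} := by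
  ext x
  simp only [mem_ball, Nat.le_zero, Finset.mem_singleton]
  constructor
  · intro h
    funext i
    have h1 := G.coordDist_le_siteDist a x i
    rw [h, Nat.le_zero] at h1
    have := (a i).2
    have := (x i).2
    ext
    unfold coordDist Nat.dist at h1
    split_ifs at h1 <;> omega
  · rintro rfl
    exact G.siteDist_self x

theorem subset_nbhd (B : Finset G.Site) {r : ℝ} (hr : 0 ≤ r) : B ⊆ G.nbhd B r := by
  intro x hx
  simp only [nbhd, Finset.mem_filter, Finset.mem_univ, true_and]
  exact ⟨x, hx, by simpa [siteDist_self] using hr⟩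

theorem notMem_nbhd_compl_ball (a : G.Site) (R : ℕ) : a ∉ G.nbhd (G.ball a R)ᶜ R := by
  simp only [nbhd, Finset.mem_filter, Finset.mem_univ, true_and, not_exists, not_and]
  intro y hy h
  rw [Finset.mem_compl, mem_ball] at hy
  exact hy (by exact_mod_cast h)

end BoxLattice

/-! Correctable regions of local codes. -/

namespace LocalProjectorCode

variable {D : ℕ} {G : BoxLattice D} {p ξ : ℕ} {K : LocalProjectorCode G p ξ}

theorem HasDistance.isCorrectable {d : ℕ} (h : K.HasDistance d) {S : Finset G.Site}
    (hS : S.card < d) : IsCorrectable K.space S := by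
  intro O hO
  by_contra hc
  exact absurd (h.2 ⟨S, O, rfl, hO, hc⟩) (not_le.mpr hS)

/-- Balls whose boundary layers are smaller than the code distance are correctable. -/
theorem HasDistance.isCorrectable_ball [NeZero p] (hD : 0 < D) {d : ℕ} (h : K.HasDistance d)
    (a : G.Site) (R : ℕ) (hR : 2 * D * (ξ + 1) * (2 * (R + 1)) ^ (D - 1) < d) :
    IsCorrectable K.space (G.ball a R) := by
  induction R with
  | zero =>
    refine h.isCorrectable ?_
    rw [G.ball_zero, Finset.card_singleton]
    refine lt_of_le_of_lt ?_ hR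
    exact Nat.one_le_iff_ne_zero.mpr (by positivity)
  | succ R ih =>
    have hM := ih (lt_of_le_of_lt
      (Nat.mul_le_mul_left _ (Nat.pow_le_pow_left (by omega) _)) hR)
    let N₁ : Finset G.Site :=
      Finset.univ.filter fun x => R < G.siteDist a x + ξ ∧ G.siteDist a x ≤ R
    let N₂ : Finset G.Site := Finset.univ.filter fun x => G.siteDist a x = R + 1
    have hN : N₁ ∪ N₂ ⊆ G.layer ξ a R := by
      intro x hx
      simp only [N₁, N₂, BoxLattice.layer, Finset.mem_union, Finset.mem_filter, Finset.mem_univ,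
        true_and] at hx ⊢
      omega
    have hball : G.ball a (R + 1) = G.ball a R ∪ N₂ := by
      ext x
      simp only [N₂, BoxLattice.mem_ball, Finset.mem_union, Finset.mem_filter, Finset.mem_univ,
        true_and]
      omega
    rw [hball]
    refine isCorrectable_union K.isHermitian K.commute (fun ψ => Iff.rfl) (N₁ := N₁) ?_ ?_ ?_ hM ?_
    · intro x hx
      simp only [N₁, Finset.mem_filter] at hx
      exact G.mem_ball.mpr hx.2.2
    · rw [Finset.disjoint_left]
      intro x hx hx'
      simp only [N₂, BoxLattice.mem_ball, Finset.mem_filter, Finset.mem_univ, true_and] at hx hx'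
      omega
    · intro b
      -- A projection that reaches a site at distance more than `R` from `a` has, by its diameter,
      -- no site at distance `R - ξ` or less.
      obtain ⟨S, hS, hdiam⟩ := K.isLocal b
      by_cases hin : S ⊆ G.ball a R
      · exact Or.inl (hS.mono hin)
      · right
        refine hS.mono fun x hx => ?_
        obtain ⟨y, hy, hy'⟩ := Finset.not_subset.mp hin
        have h1 := G.siteDist_triangle a x y
        have h2 := hdiam x hx y hy
        simp only [N₁, BoxLattice.mem_ball, Finset.mem_union, Finset.mem_filter, Finset.mem_univ,
          true_and, Finset.mem_compl] at hy' ⊢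
        omega
    · exact h.isCorrectable
        ((Finset.card_le_card hN).trans_lt ((G.card_layer_le hD ξ a R).trans_lt hR))

end LocalProjectorCode

/-! Encoding times. -/

theorem unitary_mulVec_dotProduct {X : Type} [Fintype X] [DecidableEq X] {U : Op X}
    (hU : U ∈ Matrix.unitaryGroup X ℂ) (ψ χ : X → ℂ) :
    star (U *ᵥ ψ) ⬝ᵥ (U *ᵥ χ) = star ψ ⬝ᵥ χ := by
  rw [Matrix.star_mulVec, ← Matrix.dotProduct_mulVec, Matrix.mulVec_mulVec,
    ← Matrix.star_eq_conjTranspose, Matrix.mem_unitaryGroup_iff'.mp hU, Matrix.one_mulVec]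

/-- A code into which the unencoded states of no qudits are encoded has no distance. -/
theorem LocalProjectorCode.HasDistance.nonempty_of_encodes {D : ℕ} {G : BoxLattice D} {p ξ : ℕ}
    {K : LocalProjectorCode G p ξ} {d : ℕ} (hK : K.HasDistance d) {A : Finset G.Site}
    {φ : {j : G.Site // j ∉ A} → EuclideanSpace ℂ (Fin p)} {E : SuperOp (G.Site → Fin p)} {ε : ℝ}
    (hE : Encodes E (unencodedSpace A φ) K.space ε) : A.Nonempty := by
  rw [Finset.nonempty_iff_ne_empty]
  rintro rfl
  obtain ⟨U, -, hUV, -⟩ := hE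
  obtain ⟨S, O, -, -, hO⟩ := hK.1
  refine hO (isDetectable_of_le_span_singleton
    (v := U *ᵥ tensorProductState ∅ φ fun _ => 1) ?_ O)
  rw [← hUV]
  rintro _ ⟨_, ⟨χ, rfl⟩, rfl⟩
  have hχ : χ = χ default • fun _ => 1 := by
    ext u
    simp [Subsingleton.elim u default]
  rw [Submodule.mem_span_singleton]
  refine ⟨χ default, ?_⟩
  conv_rhs => rw [hχ, map_smul, map_smul]
  rfl

/-- If a ball around an unencoded qudit is correctable, then the encoder has to move information
out of the ball. -/
theorem one_sub_le_of_isLocalizable {D : ℕ} {G : BoxLattice D} {p : ℕ} (hp : 2 ≤ p)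
    {V : Submodule ℂ ((G.Site → Fin p) → ℂ)} {A : Finset G.Site}
    {φ : {j : G.Site // j ∉ A} → EuclideanSpace ℂ (Fin p)} (hφ : ∀ j, ‖φ j‖ = 1)
    {E : SuperOp (G.Site → Fin p)} {ε : ℝ} (hE : Encodes E (unencodedSpace A φ) V ε)
    {err : ℝ → ℝ} (herr : IsLocalizable G E err) {a : G.Site} (ha : a ∈ A) {R : ℕ} (hR : 0 < R)
    (hball : IsCorrectable V (G.ball a R)) (herr0 : 0 ≤ err R) :
    1 - ε ≤ Fintype.card G.Site * err R := by
  have : NeZero p := ⟨by omega⟩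
  have : Nontrivial (Fin p) := Fin.nontrivial_iff_two_le.mpr hp
  obtain ⟨s₀, s₁, hs⟩ := exists_pair_ne (Fin p)
  obtain ⟨U, hU, hUV, hUε⟩ := hE
  let u : A → Fin p := fun _ => s₀
  let u' : A → Fin p := fun i => if (i : G.Site) = a then s₁ else s₀
  have huu : u ≠ u' := fun h => hs (by simpa [u, u'] using congrFun h ⟨a, ha⟩)
  -- Swapping two basis labels at `a` interchanges the two product vectors. The factors `φ j` are
  -- unaffected because `a ∈ A`.
  let π : G.Site → Equiv.Perm (Fin p) := fun i => if i = a then Equiv.swap s₀ s₁ else 1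
  let ψ := tensorProductState A φ (Pi.single u 1)
  let ψ' := tensorProductState A φ (Pi.single u' 1)
  have hψψ' : ψ' = ψ ∘ Equiv.piCongrRight π := by
    ext x
    simp only [ψ, ψ', tensorProductState, LinearMap.coe_mk, AddHom.coe_mk, Function.comp_apply]
    congr 1
    · have h1 : (fun i : A => Equiv.piCongrRight π x i) = u ↔ (fun i : A => x i) = u' := by
        rw [funext_iff, funext_iff]
        refine forall_congr' fun i => ?_
        by_cases hi : (i : G.Site) = a
        · simp only [Equiv.piCongrRight_apply, Pi.map_apply, π, u, u', hi, if_true]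
          rw [Equiv.swap_apply_eq_iff, Equiv.swap_apply_left]
        · simp [π, u, u', hi]
      simp only [Pi.single_apply, h1]
    · refine Finset.prod_congr rfl fun j _ => ?_
      have hj : (j : G.Site) ≠ a := fun h => j.2 (h ▸ ha)
      simp [π, hj]
  have hmem : ψ ∈ unencodedSpace A φ := ⟨_, rfl⟩
  have hmem' : ψ' ∈ unencodedSpace A φ := ⟨_, rfl⟩
  have hψ : star ψ ⬝ᵥ ψ = 1 := by
    rw [tensorProductState_inner hφ]
    simp
  have hψ' : star ψ' ⬝ᵥ ψ' = 1 := by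
    rw [tensorProductState_inner hφ]
    simp
  have horth : star ψ ⬝ᵥ ψ' = 0 := by
    rw [tensorProductState_inner hφ]
    simp [huu.symm]
  have hV : ∀ η ∈ unencodedSpace A φ, U *ᵥ η ∈ V := by
    intro η hη
    rw [← hUV]
    exact ⟨η, hη, rfl⟩
  obtain ⟨O, hO, hOO, hOB, h₀, h₁⟩ := exists_distinguishing_op (S := (G.ball a R)ᶜ)
    (by rwa [compl_compl]) (hV ψ hmem) (hV ψ' hmem')
    (by rw [unitary_mulVec_dotProduct hU, horth])
  have hRpos : (0 : ℝ) < R := by exact_mod_cast hR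
  obtain ⟨F, -, hF⟩ := herr R hRpos (G.ball a R)ᶜ
  have hπ : ∀ i ∈ G.nbhd (G.ball a R)ᶜ R, π i = 1 := by
    intro i hi
    have : i ≠ a := by
      intro h
      rw [h] at hi
      exact G.notMem_nbhd_compl_ball a R hi
    simp [π, this]
  have hE₀ := hUε _ (isStateOn_vecMulVec hmem hψ)
  have hE₁ := hUε _ (isStateOn_vecMulVec hmem' hψ')
  have hUψ' := unitary_mulVec_dotProduct hU ψ' ψ'
  rw [hψ'] at hUψ'
  rw [hψψ'] at hψ' h₁ hE₁ hUψ'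
  refine (one_sub_le_opNorm_of_distinguishable hπ F hO hOO
    (hOB.mono (G.subset_nbhd _ hRpos.le)) ((unitary_mulVec_dotProduct hU ψ ψ).trans hψ) hUψ' hψ
    hψ' h₀ h₁ hE₀ hE₁).trans ((hF O hO hOB).trans ?_)
  refine mul_le_mul_of_nonneg_right ?_ herr0
  calc opNorm O * ((G.ball a R)ᶜ.card : ℝ) ≤ 1 * (Fintype.card G.Site : ℝ) := by
        refine mul_le_mul (opNorm_le_one_of_isHermitian_of_sq_eq_one hO hOO) ?_ (by positivity)
          zero_le_one
        exact_mod_cast Finset.card_le_univ _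
    _ = _ := one_mul _

/-- The choice of the radius: the boundary of a cube of linear size `d ^ (1 / m)` is smaller than
`d`, and the Lieb-Robinson error at this radius is small. -/
theorem exists_radius (m : ℕ) (hm : 1 ≤ m) (k : ℕ) (hk : 1 ≤ k) {c₀ α : ℝ} (hc₀ : 0 < c₀)
    (hα : 0 < α) {C v γ : ℝ} (hC : 0 ≤ C) (hv : 0 ≤ v) (hγ : 0 < γ) {η : ℝ} (hη : 0 < η) :
    ∃ c : ℝ, 0 < c ∧ ∃ d₀ : ℕ, ∀ d n : ℕ, ∀ t : ℝ, c₀ * (n : ℝ) ^ α ≤ (d : ℝ) → d₀ ≤ d →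
      t < c * (d : ℝ) ^ (1 / (m : ℝ)) →
      ∃ R : ℕ, 0 < R ∧ k * (2 * (R + 1)) ^ m < d ∧
        (n : ℝ) * (C * Real.exp (v * t - γ * R)) < η := by
  have hm' : (0 : ℝ) < m := by exact_mod_cast hm
  have hk' : (1 : ℝ) ≤ k := by exact_mod_cast hk
  -- With `R + 1 = ⌊δ * s⌋` and `s = d ^ (1 / m)`, this gives `k * (2 * (R + 1)) ^ m ≤ k * 2 * δ * d
  -- = d / 2`. For `δ * s ≥ 4` the rounding still leaves `R ≥ δ * s / 2`, so `γ * R ≥ 2 * b * s`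
  -- with `b = γ * δ / 4`.
  set δ : ℝ := 1 / (4 * k) with hδ
  have hδ0 : 0 < δ := by positivity
  set b : ℝ := γ * δ / 4 with hb
  have hb0 : 0 < b := by positivity
  set c₁ : ℝ := (1 / c₀) ^ (1 / α) * C with hc₁
  have hlim : Filter.Tendsto (fun d : ℕ => (d : ℝ) ^ (1 / (m : ℝ))) Filter.atTop Filter.atTop :=
    (tendsto_rpow_atTop (by positivity)).comp tendsto_natCast_atTop_atTop
  have hlim' : Filter.Tendsto (fun s : ℝ => c₁ * (s ^ (m / α) * Real.exp (-b * s)))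
      Filter.atTop (nhds 0) := by
    simpa using (tendsto_rpow_mul_exp_neg_mul_atTop_nhds_zero (m / α) b hb0).const_mul c₁
  have hev := hlim.eventually ((hlim'.eventually (gt_mem_nhds hη)).and
    (Filter.eventually_ge_atTop (4 / δ)))
  obtain ⟨d₀, hd₀⟩ := Filter.eventually_atTop.mp (hev.and (Filter.eventually_ge_atTop 1))
  -- This constant keeps `v * t ≤ b * s`, half of the available decay. The summand `1` covers `v =
  -- 0`.
  refine ⟨b / (v + 1), by positivity, d₀, fun d n t hn hd ht => ?_⟩
  obtain ⟨⟨hsmall, hlarge⟩, hd1⟩ := hd₀ d hd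
  set s : ℝ := (d : ℝ) ^ (1 / (m : ℝ)) with hs
  have hd0 : (0 : ℝ) < d := by exact_mod_cast hd1
  have hs0 : 0 < s := Real.rpow_pos_of_pos hd0 _
  have hsm : s ^ m = d := by
    rw [hs, one_div]
    exact Real.rpow_inv_natCast_pow hd0.le (by omega)
  have hδs : 4 ≤ δ * s := by
    rw [div_le_iff₀ hδ0] at hlarge
    linarith
  have hfl : (1 : ℕ) ≤ ⌊δ * s⌋₊ := Nat.le_floor (by push_cast; linarith)
  obtain ⟨R, hR⟩ := Nat.exists_eq_add_of_le' hfl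
  have hR1 : (R : ℝ) + 1 ≤ δ * s := by
    have := Nat.floor_le (by positivity : 0 ≤ δ * s)
    rw [hR] at this
    exact_mod_cast this
  have hR2 : δ * s < R + 2 := by
    have := Nat.lt_floor_add_one (δ * s)
    rw [hR] at this
    push_cast at this
    linarith
  refine ⟨R, ?_, ?_, ?_⟩
  · have : (0 : ℝ) < R := by linarith
    exact_mod_cast this
  · have h1 : (2 * δ) ^ m ≤ 2 * δ := by
      refine pow_le_of_le_one (by positivity) ?_ (by omega)
      rw [hδ, mul_one_div, div_le_one (by positivity)]
      linarith
    have h2 : (k : ℝ) * (2 * δ) < 1 := by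
      rw [hδ, mul_one_div, mul_div_assoc', div_lt_one (by positivity)]
      linarith
    have h3 : (k : ℝ) * (2 * ((R : ℝ) + 1)) ^ m < d := by
      calc (k : ℝ) * (2 * ((R : ℝ) + 1)) ^ m ≤ k * (2 * (δ * s)) ^ m := by gcongr
        _ = k * ((2 * δ) ^ m * d) := by rw [← mul_assoc, mul_pow, hsm]
        _ ≤ k * (2 * δ * d) := by gcongr
        _ = k * (2 * δ) * d := by ring
        _ < 1 * d := by gcongr
        _ = d := one_mul _
    exact_mod_cast h3
  · have h1 : v * t - γ * R ≤ -b * s := by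
      have h2 : v * t ≤ b * s := by
        calc v * t ≤ v * (b / (v + 1) * s) := by gcongr
          _ = v / (v + 1) * (b * s) := by ring
          _ ≤ 1 * (b * s) := by
              gcongr
              rw [div_le_one (by positivity)]
              linarith
          _ = b * s := one_mul _
      have h3 : δ * s / 2 ≤ R := by linarith
      have h4 : γ * (δ * s / 2) ≤ γ * R := by gcongr
      have h5 : γ * (δ * s / 2) = 2 * (b * s) := by rw [hb]; ring
      linarith
    -- The hypothesis `c₀ * n ^ α ≤ d` makes the number of sites polynomial in `s`, so the
    -- exponential `exp (-b * s)` dominates it.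
    have h6 : (n : ℝ) ≤ (1 / c₀) ^ (1 / α) * s ^ (m / α) := by
      have h7 : (n : ℝ) ^ α ≤ 1 / c₀ * d := by
        rw [one_div, ← div_eq_inv_mul, le_div_iff₀ hc₀]
        linarith
      calc (n : ℝ) = ((n : ℝ) ^ α) ^ (1 / α) := by
            rw [← Real.rpow_mul (by positivity), mul_one_div, div_self hα.ne', Real.rpow_one]
        _ ≤ (1 / c₀ * d) ^ (1 / α) := by gcongr
        _ = (1 / c₀) ^ (1 / α) * (d : ℝ) ^ (1 / α) := Real.mul_rpow (by positivity) hd0.le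
        _ = _ := by
            rw [hs, ← Real.rpow_mul hd0.le]
            congr 2
            field_simp
    calc (n : ℝ) * (C * Real.exp (v * t - γ * R))
        ≤ ((1 / c₀) ^ (1 / α) * s ^ (m / α)) * (C * Real.exp (-b * s)) := by gcongr
      _ = c₁ * (s ^ (m / α) * Real.exp (-b * s)) := by rw [hc₁]; ring
      _ < η := hsmall

theorem theorem1 (D : ℕ) (hD : 2 ≤ D) (ξ : ℕ) (c₀ α : ℝ) (hc₀ : 0 < c₀) (hα : 0 < α)
    (C v γ : ℝ) (hC : 0 ≤ C) (hv : 0 ≤ v) (hγ : 0 < γ) (ε : ℝ) (hε : ε < 1) :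
    ∃ c : ℝ, 0 < c ∧ ∃ d₀ : ℕ,
      ∀ (G : BoxLattice D) (p : ℕ), 2 ≤ p →
      ∀ (K : LocalProjectorCode G p ξ) (d : ℕ), K.HasDistance d →
        c₀ * (Fintype.card G.Site : ℝ) ^ α ≤ (d : ℝ) → d₀ ≤ d →
      ∀ (A : Finset G.Site) (φ : {j : G.Site // j ∉ A} → EuclideanSpace ℂ (Fin p)),
        (∀ j, ‖φ j‖ = 1) →
      ∀ E : ℝ → SuperOp (G.Site → Fin p), (∀ t : ℝ, 0 ≤ t → IsCPTP (E t)) →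
        IsLiebRobinson G E C v γ →
      ∀ t : ℝ, 0 < t → Encodes (E t) (unencodedSpace A φ) K.space ε →
        c * (d : ℝ) ^ (1 / ((D : ℝ) - 1)) ≤ t := by
  -- The exponent `D - 1` and the factor `2 * D * (ξ + 1)` are those of the layer bound. The
  -- threshold `1 - ε` is what the Lieb-Robinson error must reach.
  obtain ⟨c, hc, d₀, hR⟩ := exists_radius (D - 1) (by omega) (2 * D * (ξ + 1))
    (Nat.one_le_iff_ne_zero.mpr (by positivity)) hc₀ hα hC hv hγ (sub_pos.mpr hε)
  refine ⟨c, hc, d₀, ?_⟩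
  intro G p hp K d hK hd hd₀ A φ hφ E _ hLR t ht hE
  by_contra! hlt
  have : NeZero p := ⟨by omega⟩
  have hcast : ((D - 1 : ℕ) : ℝ) = (D : ℝ) - 1 := by
    rw [Nat.cast_sub (by omega), Nat.cast_one]
  rw [← hcast] at hlt
  obtain ⟨R, hR0, hRd, hRη⟩ := hR d (Fintype.card G.Site) t hd hd₀ hlt
  obtain ⟨a, ha⟩ := hK.nonempty_of_encodes hE
  exact absurd hRη (not_lt.mpr (one_sub_le_of_isLocalizable hp hφ hE (hLR t ht.le) ha hR0
    (hK.isCorrectable_ball (by omega) a R hRd) (by positivity)))
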